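/- Let $\mathbb D=\{z\in\mathbb C:|z|<1\}$, $\mathbb T=\partial\mathbb D$, let $H^\infty$ be the space of bounded holomorphic functions on $\mathbb D$ (identified with their boundary functions, defined almost everywhere on $\mathbb T$), and let $H^\infty_0=\{g\in H^\infty: g(0)=0\}$. Let $\{a_j\}_{j\ge1}$ be an infinite sequence in $\mathbb D$ with $\sum_j(1-|a_j|)<\infty$, and let $$B(z)=\prod_{j}\frac{|a_j|}{a_j}\,\frac{a_j-z}{1-\overline{a_j}z}$$ (with $|a_j|/a_j:=-1$ if $a_j=0$) be its Blaschke product. Assume that $B$ is an interpolating Blaschke product, i.e. $\inf_j|B'(a_j)|(1-|a_j|)>0$. Let $K^\infty_B=H^\infty\cap B\,\overline{H^\infty_0}$, that is, the set of all $f\in H^\infty$ for which there is a $g\in H^\infty_0$ with $f=B\overline g$ almost everywhere on $\mathbb T$, and let $K^\infty_B|_{\{a_j\}}$ be the set of all complex sequences $\{w_j\}$ for which there is an $f\in K^\infty_B$ with $f(a_j)=w_j$ for all $j$. Then: (a) $\ell^1\subset K^\infty_B|_{\{a_j\}}$. (b) Suppose that $0\le a_1<a_2<\dots<1$, and let $X$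 be an ideal sequence space, that is, a vector space of complex sequences such that whenever $\{x_j\}\in X$ and $\{y_j\}$ is a complex sequence with $|y_j|\le|x_j|$ for all $j$, also $\{y_j\}\in X$. If $X\subset K^\infty_B|_{\{a_j\}}$, then $X\subset\ell^1$. -/

import Mathlib

open Complex Filter Topology Metric

noncomputable section

namespace ModelTrace

/-- `H^∞`: the bounded holomorphic functions on the open unit disk
(only the values on the disk matter). -/
def HInf : Set (ℂ → ℂ) :=
  {f | DifferentiableOn ℂ f (ball 0 1) ∧ ∃ C : ℝ, ∀ z ∈ ball (0 : ℂ) 1, ‖f z‖ ≤ C}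

/-- `F` is the boundary function of `f` on the unit circle: `f(rζ) → F(ζ)` as `r ↑ 1`, for almost
every `ζ = e^{it}` with respect to arclength. -/
def IsBoundaryFunction (f : ℂ → ℂ) (F : Circle → ℂ) : Prop :=
  ∀ᵐ t : ℝ, Tendsto (fun r : ℝ => f ((r : ℂ) * (Circle.exp t : ℂ))) (𝓝[<] 1)
    (𝓝 (F (Circle.exp t)))

/-- The star-invariant subspace `K^∞_θ = H^∞ ∩ θ \overline{H^∞_0}`: those `f ∈ H^∞` for which there
is `g ∈ H^∞` with `g(0) = 0` such that the boundary functions satisfy `f = θ \overline{g}` almost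
everywhere on the unit circle. -/
def modelSpace (θ : ℂ → ℂ) : Set (ℂ → ℂ) :=
  {f | f ∈ HInf ∧ ∃ g ∈ HInf, g 0 = 0 ∧ ∃ F G Θ : Circle → ℂ,
    IsBoundaryFunction f F ∧ IsBoundaryFunction g G ∧ IsBoundaryFunction θ Θ ∧
    ∀ᵐ t : ℝ, F (Circle.exp t) = Θ (Circle.exp t) * (starRingEnd ℂ) (G (Circle.exp t))}

/-- The Blaschke factor `b_a(z) = (|a|/a) (a - z)/(1 - \bar a z)`, where `|a|/a` is read as `-1`
if `a = 0`. -/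
def blaschkeFactor (a z : ℂ) : ℂ :=
  (if a = 0 then -1 else (‖a‖ : ℂ) / a) * ((a - z) / (1 - (starRingEnd ℂ) a * z))

/-- The Blaschke product `B(z) = ∏_j b_{a_j}(z)` of a sequence `a`. -/
def blaschkeProduct (a : ℕ → ℂ) (z : ℂ) : ℂ :=
  ∏' j, blaschkeFactor (a j) z

/-- `a` is the zero sequence of an interpolating Blaschke product `B`: it lies in the disk,
`∑ (1 - |a_j|) < ∞`, and `inf_j |B'(a_j)| (1 - |a_j|) > 0`. -/
structure IsInterpolatingBlaschke (a : ℕ → ℂ) : Prop where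
  mem_disk : ∀ j, a j ∈ ball (0 : ℂ) 1
  summable : Summable fun j => 1 - ‖a j‖
  inf_pos : ∃ δ : ℝ, 0 < δ ∧ ∀ j, δ ≤ ‖deriv (blaschkeProduct a) (a j)‖ * (1 - ‖a j‖)

/-- The trace of a function space on a sequence: all `w` for which `f(a_j) = w_j` (all `j`)
is solvable with `f` in the space. -/
def trace (𝒳 : Set (ℂ → ℂ)) (a : ℕ → ℂ) : Set (ℕ → ℂ) :=
  {w | ∃ f ∈ 𝒳, ∀ j, f (a j) = w j}

/-- The sequence space `ℓ^1`. -/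
def ellOne : Set (ℕ → ℂ) :=
  {w | Memℓp w 1}

/-- A vector space of complex sequences is ideal if it contains, with `x`, every sequence `y`
such that `|y_j| ≤ |x_j|` for all `j`. -/
def IsIdealSpace (X : Submodule ℂ (ℕ → ℂ)) : Prop :=
  ∀ x ∈ X, ∀ y : ℕ → ℂ, (∀ j, ‖y j‖ ≤ ‖x j‖) → y ∈ X

end ModelTrace

end

/-! Part (a) is a partial fraction expansion: f = B Σ c_j/(z − a_j) with c_j = w_j/B'(a_j). Since
|B| is at most the modulus of its j-th factor, B/((z − a_j)B'(a_j)) is bounded by 1/(|B'(a_j)|(1 −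
|a_j|)) ≤ 1/δ, so the series converges uniformly for w in ℓ^1. On the circle 1/(ζ − a_j) is the
conjugate of ζ/(1 − ā_j ζ), which gives f = B ḡ with g = Σ c̄_j z/(1 − ā_j z), bounded and zero at
the origin. Taking radial limits inside Σ c_j/(rζ − a_j) requires |rζ − a_j| ≥ (1 − |a_j|)/2 for all
j once r is near 1. Almost every ζ has this property, because the sum of (1 − |a_j|) times the
Poisson kernel at a_j has finite integral (`ae_eventually_three_mul_le`). The boundary function of B
comes from Fatou's theorem, proved here by differentiating a Lipschitz primitive along the circle.

Part (b) is a duality argument against Cauchy kernels. If f = B ḡ on the circle and |g| ≤ M, then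
pairing f/B with 1/(1 − rz) gives Σ f(a_i)/((1 − r a_i)B'(a_i)) by residues, and a number of modulus
at most M/r by Cauchy's formula for g. Ideality allows f(a_i) = ±|w_i| with the sign of B'(a_i), so
every term is nonnegative. As 1/|B'(a_i)| ≥ 1 − a_i² ≥ 1 − a_i, this yields Σ |w_i|(1 − a_i)/(1 − r
a_i) ≤ M/r, and r → 1 gives Σ |w_i| ≤ M. To justify the residue computation
(`norm_sum_residues_le`), B is replaced by a finite product and the circle by |z| = ρ. The errors
vanish because f − B ḡ → 0 in mean as ρ → 1 and the tail products tend to 1 in mean. -/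

namespace ModelTrace

/-! ### Poisson and Cauchy kernels on the unit circle -/

open MeasureTheory Real in
/-- The Poisson kernel of the unit disk has integral `2π` over the circle. -/
theorem integral_poissonKernel_eq {z : ℂ} (hz : z ∈ ball (0 : ℂ) 1) :
    ∫ t in (0 : ℝ)..2 * π, (1 - ‖z‖ ^ 2) / ‖circleMap 0 1 t - z‖ ^ 2 = 2 * π := by
  have h := DiffContOnCl.circleAverage_poissonKernel_smul' (f := fun _ => (1 : ℂ))
    (diffContOnCl_const (s := ball (0 : ℂ) 1)) hz
  simp only [circleAverage, sub_zero, norm_circleMap_zero, abs_one, one_pow] at h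
  have h2 : ∫ t in (0 : ℝ)..2 * π,
      ((1 - ‖z‖ ^ 2) / ‖circleMap 0 1 t - z‖ ^ 2) • (1 : ℂ) =
      ((∫ t in (0 : ℝ)..2 * π, (1 - ‖z‖ ^ 2) / ‖circleMap 0 1 t - z‖ ^ 2 : ℝ) : ℂ) := by
    rw [← intervalIntegral.integral_ofReal]
    simp
  rw [h2] at h
  have h3 : (2 * π)⁻¹ *
      ∫ t in (0 : ℝ)..2 * π, (1 - ‖z‖ ^ 2) / ‖circleMap 0 1 t - z‖ ^ 2 = 1 := by
    have := congrArg Complex.re h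
    simpa using this
  field_simp at h3
  linarith

/-- Cauchy's formula for the derivative on the unit disk, for functions continuous up to the
boundary. -/
theorem circleIntegral_sub_sq_inv_smul_eq_deriv {E : ℂ → ℂ}
    (hE : DiffContOnCl ℂ E (ball 0 1)) {z : ℂ} (hz : z ∈ ball (0 : ℂ) 1) :
    ∮ w in C(0, 1), ((w - z) ^ 2)⁻¹ * E w = 2 * Real.pi * I * deriv E z := by
  have hsph : ∀ w ∈ sphere (0 : ℂ) 1, w - z ≠ 0 := by
    intro w hw h
    rw [sub_eq_zero] at h
    subst h
    simp at hw hz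
    linarith
  -- Cauchy's formula is applied to (E w − E z)/(w − z), whose value at w = z is E'(z). The constant
  -- E z drops out because (w − z)⁻² has a primitive.
  have hE' : DiffContOnCl ℂ (dslope E z) (ball 0 1) := by
    refine ⟨(Complex.differentiableOn_dslope (isOpen_ball.mem_nhds hz)).mpr hE.1, ?_⟩
    have hnb : closure (ball (0 : ℂ) 1) ∈ 𝓝 z :=
      mem_of_superset (isOpen_ball.mem_nhds hz) subset_closure
    rw [continuousOn_dslope hnb]
    exact ⟨hE.2, hE.differentiableAt isOpen_ball hz⟩
  have h0 := hE'.circleIntegral_sub_inv_smul hz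
  simp only [smul_eq_mul, dslope_same] at h0
  rw [← h0]
  have hEc : ContinuousOn E (sphere 0 1) := hE.continuousOn_ball.mono sphere_subset_closedBall
  have h1 : ContinuousOn (fun w : ℂ => ((w - z) ^ 2)⁻¹) (sphere 0 1) :=
    ((continuous_id'.sub continuous_const).pow 2).continuousOn.inv₀
      fun w hw => pow_ne_zero 2 (hsph w hw)
  have h2 : CircleIntegrable (fun w : ℂ => ((w - z) ^ 2)⁻¹ * E w) 0 1 :=
    (h1.mul hEc).circleIntegrable zero_le_one
  have h3 : CircleIntegrable (fun w : ℂ => ((w - z) ^ 2)⁻¹ * E z) 0 1 :=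
    (h1.mul continuousOn_const).circleIntegrable zero_le_one
  have h4 : (∮ w in C(0, 1), ((w - z) ^ 2)⁻¹ * E z) = 0 := by
    have h5 := circleIntegral.integral_sub_zpow_of_ne (by decide : (-2 : ℤ) ≠ -1) 0 z 1
    have h6 : (∮ w in C(0, 1), ((w - z) ^ 2)⁻¹) = 0 := by simpa using! h5
    have h7 := circleIntegral.integral_smul_const (fun w : ℂ => ((w - z) ^ 2)⁻¹) (E z) 0 1
    simp only [smul_eq_mul] at h7
    rw [h7, h6, zero_mul]
  trans ∮ w in C(0, 1), (((w - z) ^ 2)⁻¹ * E w - ((w - z) ^ 2)⁻¹ * E z)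
  · rw [circleIntegral.integral_sub h2 h3, h4, sub_zero]
  · refine circleIntegral.integral_congr zero_le_one fun w hw => ?_
    have hne := hsph w hw
    rw [dslope_of_ne _ (sub_ne_zero.mp hne), slope_def_field]
    field_simp

/-- With the pole outside the disk the integrand is holomorphic. This permits subtracting the kernel
at the reflected point ζ/r at no cost. -/
theorem circleIntegral_sub_sq_inv_smul_eq_zero {E : ℂ → ℂ}
    (hE : DiffContOnCl ℂ E (ball 0 1)) {z : ℂ} (hz : 1 < ‖z‖) :
    ∮ w in C(0, 1), ((w - z) ^ 2)⁻¹ * E w = 0 := by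
  have hne : ∀ w ∈ closedBall (0 : ℂ) 1, (w - z) ^ 2 ≠ 0 := by
    intro w hw h
    have h := sub_eq_zero.mp (pow_eq_zero_iff two_ne_zero |>.mp h)
    subst h
    simp at hw
    linarith
  refine DiffContOnCl.circleIntegral_eq_zero zero_le_one ?_
  refine DiffContOnCl.smul (c := fun w : ℂ => ((w - z) ^ 2)⁻¹) (f := E) ?_ hE
  refine DiffContOnCl.inv (Differentiable.diffContOnCl (by fun_prop)) ?_
  rw [closure_ball _ one_ne_zero]
  exact hne

/-- The difference of the derivative kernels at the point `rζ` and at its reflection `ζ / r` in the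
unit circle. -/
theorem norm_sq_inv_sub_sq_inv_le {ζ w : ℂ} (hζ : ‖ζ‖ = 1) (hw : ‖w‖ = 1) {r : ℝ} (hr : 0 < r)
    (hr1 : r < 1) :
    ‖((w - r * ζ) ^ 2)⁻¹ - ((w - ζ / r) ^ 2)⁻¹‖ ≤ 2 * (1 - r ^ 2) / ‖w - r * ζ‖ ^ 3 := by
  have hrc : (r : ℂ) ≠ 0 := by exact_mod_cast hr.ne'
  -- The unit circle is an Apollonius circle for the inverse points rζ and ζ/r.
  have hd : ‖w - ζ / r‖ = ‖w - r * ζ‖ / r := by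
    have h1 : ‖w - ζ / r‖ ^ 2 = (‖w - r * ζ‖ / r) ^ 2 := by
      rw [div_pow, ← normSq_eq_norm_sq, ← normSq_eq_norm_sq]
      have hζ2 : ζ.re * ζ.re + ζ.im * ζ.im = 1 := by
        rw [← normSq_apply, normSq_eq_norm_sq, hζ, one_pow]
      have hw2 : w.re * w.re + w.im * w.im = 1 := by
        rw [← normSq_apply, normSq_eq_norm_sq, hw, one_pow]
      simp only [normSq_apply, sub_re, sub_im, div_ofReal_re, div_ofReal_im, re_ofReal_mul,
        im_ofReal_mul]
      field_simp
      linear_combination (1 - r ^ 2) * hζ2 + (r ^ 2 - 1) * hw2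
    exact (pow_left_inj₀ (norm_nonneg _) (by positivity) two_ne_zero).mp h1
  have hpos : 0 < ‖w - r * ζ‖ := by
    have := norm_sub_norm_le w (r * ζ)
    rw [norm_mul, hζ, hw, norm_real, Real.norm_of_nonneg hr.le] at this
    linarith
  have hne : w - r * ζ ≠ 0 := norm_pos_iff.mp hpos
  have hne' : w - ζ / r ≠ 0 := by
    rw [← norm_pos_iff, hd]; positivity
  have hK : ((w - r * ζ) ^ 2)⁻¹ - ((w - ζ / r) ^ 2)⁻¹ =
      (r * ζ - ζ / r) * ((w - ζ / r) + (w - r * ζ)) / ((w - r * ζ) ^ 2 * (w - ζ / r) ^ 2) := by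
    rw [show r * ζ - ζ / r = (w - ζ / r) - (w - r * ζ) by ring]
    generalize w - r * ζ = p at hne
    generalize w - ζ / r = q at hne'
    field_simp
    ring
  rw [hK, norm_div, norm_mul, norm_mul, norm_pow, norm_pow, hd]
  have h1 : ‖r * ζ - ζ / r‖ = (1 - r ^ 2) / r := by
    have : r * ζ - ζ / r = -(((1 - r ^ 2) / r : ℝ) : ℂ) * ζ := by
      push_cast
      field_simp
      ring
    rw [this, norm_mul, hζ, norm_neg, norm_real, Real.norm_of_nonneg, mul_one]
    apply div_nonneg _ hr.le
    nlinarith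
  have h2 : ‖(w - ζ / r) + (w - r * ζ)‖ ≤ ‖w - r * ζ‖ / r + ‖w - r * ζ‖ := by
    refine (norm_add_le _ _).trans ?_
    rw [hd]
  rw [h1]
  set d := ‖w - r * ζ‖
  have h3 : 0 ≤ 1 - r ^ 2 := by nlinarith
  calc (1 - r ^ 2) / r * ‖(w - ζ / r) + (w - r * ζ)‖ / (d ^ 2 * (d / r) ^ 2)
      ≤ (1 - r ^ 2) / r * (d / r + d) / (d ^ 2 * (d / r) ^ 2) := by gcongr
    _ = (1 + r) * (1 - r ^ 2) / d ^ 3 := by field_simp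
    _ ≤ 2 * (1 - r ^ 2) / d ^ 3 := by gcongr; linarith

-- The reflected kernel improves the decay from |w − rζ|⁻² to (1 − r²)|w − rζ|⁻³. Against the linear
-- term of the bound this leaves a Poisson kernel, with integral independent of r; against the cubic
-- term it leaves a constant of size 1 − r².
open MeasureTheory Real in
theorem norm_deriv_le_of_boundary_bound {E : ℂ → ℂ} (hE : DiffContOnCl ℂ E (ball 0 1)) {ζ : ℂ}
    (hζ : ‖ζ‖ = 1) {ε L : ℝ} (hε : 0 ≤ ε) (hL : 0 ≤ L)
    (hb : ∀ w : ℂ, ‖w‖ = 1 → ‖E w‖ ≤ ε * ‖w - ζ‖ + L * ‖w - ζ‖ ^ 3) {r : ℝ} (hr : 0 < r)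
    (hr1 : r < 1) : ‖deriv E (r * ζ)‖ ≤ 4 * ε + 16 * L * (1 - r ^ 2) := by
  have hnz : ‖(r : ℂ) * ζ‖ = r := by
    rw [norm_mul, hζ, norm_real, norm_of_nonneg hr.le, mul_one]
  have hz : (r : ℂ) * ζ ∈ ball (0 : ℂ) 1 := by simpa [hζ, abs_of_pos hr] using hr1
  have hz' : 1 < ‖ζ / r‖ := by
    rw [norm_div, hζ, norm_real, norm_of_nonneg hr.le]
    exact (one_lt_div hr).mpr hr1
  have hEc : ContinuousOn E (sphere 0 1) := hE.continuousOn_ball.mono sphere_subset_closedBall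
  have hc : ∀ z : ℂ, ‖z‖ ≠ 1 → CircleIntegrable (fun w : ℂ => ((w - z) ^ 2)⁻¹ * E w) 0 1 := by
    intro z hz
    refine (ContinuousOn.mul ?_ hEc).circleIntegrable zero_le_one
    refine ((continuous_id'.sub continuous_const).pow 2).continuousOn.inv₀ fun w hw => ?_
    refine pow_ne_zero 2 fun h => hz ?_
    rw [← sub_eq_zero.mp (show w - z = 0 from h)]
    simpa using hw
  have key : 2 * π * I * deriv E (r * ζ) =
      ∮ w in C(0, 1), (((w - r * ζ) ^ 2)⁻¹ - ((w - ζ / r) ^ 2)⁻¹) * E w := by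
    rw [← circleIntegral_sub_sq_inv_smul_eq_deriv hE hz]
    simp_rw [sub_mul]
    rw [circleIntegral.integral_sub (hc _ (by rw [hnz]; exact hr1.ne)) (hc _ hz'.ne'),
      circleIntegral_sub_sq_inv_smul_eq_zero hE hz', sub_zero]
  have hsub : ∀ t : ℝ, circleMap 0 1 t - r * ζ ≠ 0 := by
    intro t h
    have := congrArg norm (sub_eq_zero.mp h)
    rw [hnz, norm_circleMap_zero, abs_one] at this
    linarith
  have hbound : ∀ t : ℝ, ‖deriv (circleMap 0 1) t •
      ((((circleMap 0 1 t - r * ζ) ^ 2)⁻¹ - ((circleMap 0 1 t - ζ / r) ^ 2)⁻¹) *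
        E (circleMap 0 1 t))‖ ≤
      4 * ε * ((1 - ‖(r : ℂ) * ζ‖ ^ 2) / ‖circleMap 0 1 t - r * ζ‖ ^ 2) +
        16 * L * (1 - r ^ 2) := by
    intro t
    have hw : ‖circleMap 0 1 t‖ = 1 := by simp
    have hp := norm_pos_iff.mpr (hsub t)
    have hK := norm_sq_inv_sub_sq_inv_le hζ hw hr hr1
    have hEw := hb _ hw
    -- Both |w − rζ| and |rζ − ζ| = 1 − r are at most |w − rζ|. The factor 2 produces 4 = 2·2 and 16
    -- = 2·2³.
    have hdist : ‖circleMap 0 1 t - ζ‖ ≤ 2 * ‖circleMap 0 1 t - r * ζ‖ := by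
      have h1 : ‖circleMap 0 1 t - ζ‖ ≤ ‖circleMap 0 1 t - r * ζ‖ + ‖r * ζ - ζ‖ :=
        norm_sub_le_norm_sub_add_norm_sub _ _ _
      have h2 : ‖r * ζ - ζ‖ = 1 - r := by
        have : r * ζ - ζ = -((1 - r : ℝ) : ℂ) * ζ := by push_cast; ring
        rw [this, norm_mul, hζ, norm_neg, norm_real, norm_of_nonneg (by linarith), mul_one]
      have h3 := norm_sub_norm_le (circleMap 0 1 t) (r * ζ)
      rw [hnz, hw] at h3
      linarith
    rw [norm_smul, norm_mul, deriv_circleMap, norm_mul, norm_I, hw, mul_one, one_mul, hnz]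
    set d := ‖circleMap 0 1 t - r * ζ‖
    have h3 : 0 ≤ 1 - r ^ 2 := by nlinarith
    calc _ ≤ 2 * (1 - r ^ 2) / d ^ 3 * (ε * (2 * d) + L * (2 * d) ^ 3) := by
          refine mul_le_mul hK (hEw.trans ?_) (norm_nonneg _) (by positivity)
          gcongr
      _ = _ := by
          field_simp
          ring
  have hcont : Continuous fun t : ℝ =>
      4 * ε * ((1 - ‖(r : ℂ) * ζ‖ ^ 2) / ‖circleMap 0 1 t - r * ζ‖ ^ 2) := by
    refine continuous_const.mul (continuous_const.div (by fun_prop) fun t => ?_)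
    exact pow_ne_zero 2 (norm_ne_zero_iff.mpr (hsub t))
  have hfin : ‖2 * π * I * deriv E (r * ζ)‖ ≤ 2 * π * (4 * ε + 16 * L * (1 - r ^ 2)) := by
    rw [key]
    refine (intervalIntegral.norm_integral_le_of_norm_le (by positivity)
      (Eventually.of_forall fun t _ => hbound t) ?_).trans ?_
    · exact (hcont.add continuous_const).intervalIntegrable _ _
    · rw [intervalIntegral.integral_add (hcont.intervalIntegrable _ _)
        (intervalIntegrable_const), intervalIntegral.integral_const_mul,
        integral_poissonKernel_eq hz, intervalIntegral.integral_const]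
      apply le_of_eq
      simp
      ring
  have h2π : ‖2 * π * I * deriv E (r * ζ)‖ = 2 * π * ‖deriv E (r * ζ)‖ := by
    simp [abs_of_pos Real.pi_pos]
  rw [h2π] at hfin
  exact le_of_mul_le_mul_left hfin (by positivity)

/-! ### Fatou's theorem on radial limits -/

/-- A holomorphic function on the disk that is bounded has a primitive that is Lipschitz on the
whole plane. -/
theorem exists_lipschitz_primitive {f : ℂ → ℂ} (hf : f ∈ HInf) :
    ∃ (K : NNReal) (Ψ : ℂ → ℂ), LipschitzWith K Ψ ∧
      ∀ z ∈ ball (0 : ℂ) 1, HasDerivAt Ψ (f z) z := by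
  obtain ⟨hd, C, hC⟩ := hf
  obtain ⟨g, hg⟩ := hd.isExactOn_ball
  have hlip : LipschitzOnWith C.toNNReal g (ball 0 1) := by
    refine (convex_ball (0 : ℂ) 1).lipschitzOnWith_of_nnnorm_hasDerivWithin_le
      (fun z hz => (hg z hz).hasDerivWithinAt) fun z hz => ?_
    rw [← NNReal.coe_le_coe, coe_nnnorm]
    exact (hC z hz).trans (Real.le_coe_toNNReal C)
  obtain ⟨Ψ, hΨ, heq⟩ := hlip.extend_finite_dimension
  refine ⟨_, Ψ, hΨ, fun z hz => (hg z hz).congr_of_eventuallyEq ?_⟩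
  filter_upwards [isOpen_ball.mem_nhds hz] with w hw using (heq hw).symm

/-- A function on the plane whose composition with `t ↦ e^{it}` vanishes to first order at `t` is
`o(|w - e^{it}|)` along the unit circle. -/
theorem eventually_norm_le_of_hasDerivAt_circleMap {E : ℂ → ℂ} {t : ℝ}
    (h0 : E (circleMap 0 1 t) = 0)
    (h : HasDerivAt (fun s : ℝ => E (circleMap 0 1 s)) 0 t) {ε : ℝ} (hε : 0 < ε) :
    ∀ᶠ w in 𝓝 (circleMap 0 1 t), ‖w‖ = 1 → ‖E w‖ ≤ ε * ‖w - circleMap 0 1 t‖ := by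
  set ζ := circleMap 0 1 t with hζ
  have hζn : ‖ζ‖ = 1 := by simp [hζ]
  have hζ0 : ζ ≠ 0 := norm_pos_iff.mp (by rw [hζn]; exact one_pos)
  -- On the circle, w ↦ t + Im log(w/ζ) is a local inverse of s ↦ e^{is}, with increment O(w − ζ).
  -- It carries the little-o estimate in the angle over to w.
  have hd : DifferentiableAt ℂ (fun w : ℂ => log (w / ζ)) ζ := by
    refine DifferentiableAt.clog (by fun_prop) ?_
    rw [div_self hζ0]
    exact one_mem_slitPlane
  have hlog : log (ζ / ζ) = 0 := by rw [div_self hζ0, log_one]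
  have hO : (fun w : ℂ => (t + (log (w / ζ)).im) - t) =O[𝓝 ζ] fun w => w - ζ := by
    have h1 := hd.isBigO_sub
    simp only [hlog, sub_zero] at h1
    refine Asymptotics.IsBigO.trans ?_ h1
    refine Asymptotics.isBigO_of_le _ fun w => ?_
    rw [add_sub_cancel_left]
    exact abs_im_le_norm _
  have ht : Tendsto (fun w : ℂ => t + (log (w / ζ)).im) (𝓝 ζ) (𝓝 t) := by
    have h1 : ContinuousAt (fun w : ℂ => t + (log (w / ζ)).im) ζ :=
      continuousAt_const.add (continuous_im.continuousAt.comp hd.continuousAt)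
    have h2 := h1.tendsto
    simpa only [hlog, zero_im, add_zero] using h2
  have ho := h.isLittleO
  simp only [smul_zero, sub_zero] at ho
  have ho' := (ho.comp_tendsto ht).trans_isBigO hO
  filter_upwards [ho'.def hε] with w hw hw1
  have hexp : circleMap 0 1 (t + (log (w / ζ)).im) = w := by
    have hw0 : w / ζ ≠ 0 := div_ne_zero (norm_pos_iff.mp (by rw [hw1]; exact one_pos)) hζ0
    have h3 : log (w / ζ) = (log (w / ζ)).im * I := by
      apply Complex.ext
      · simp [log_re, hw1, hζn]
      · simp
    have h4 : cexp ((log (w / ζ)).im * I) = w / ζ := by rw [← h3, exp_log hw0]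
    have h5 : cexp (t * I) = ζ := by simp [hζ, circleMap]
    simp only [circleMap, ofReal_one, one_mul, zero_add, ofReal_add, add_mul, exp_add, h4, h5]
    field_simp
  simpa only [Function.comp_apply, hexp, ← hζ, h0, sub_zero] using hw

/-- **Fatou's theorem**: a bounded holomorphic function on the disk has radial limits almost
everywhere. -/
theorem ae_exists_tendsto_radial {f : ℂ → ℂ} (hf : f ∈ HInf) :
    ∀ᵐ t : ℝ, ∃ A : ℂ,
      Tendsto (fun r : ℝ => f ((r : ℂ) * (Circle.exp t : ℂ))) (𝓝[<] 1) (𝓝 A) := by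
  obtain ⟨K, Ψ, hΨ, hder⟩ := exists_lipschitz_primitive hf
  filter_upwards [(hΨ.comp (lipschitzWith_circleMap 0 1)).ae_differentiableAt_real] with t ht
  obtain ⟨ζ, hζ⟩ : ∃ ζ, circleMap 0 1 t = ζ := ⟨_, rfl⟩
  have hcoe : (Circle.exp t : ℂ) = ζ := by simp [← hζ, circleMap]
  have hζn : ‖ζ‖ = 1 := by simp [← hζ]
  have hζ0 : ζ ≠ 0 := norm_pos_iff.mp (by rw [hζn]; exact one_pos)
  set D := deriv (Ψ ∘ circleMap 0 1) t with hD
  -- The tangential derivative of Ψ along e^{is} is formally Ψ'(ζ)·iζ, and Ψ' = f inside the disk,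
  -- so D/(iζ) is the candidate limit.
  obtain ⟨A, hA⟩ : ∃ A, A = D / (ζ * I) := ⟨_, rfl⟩
  refine ⟨A, ?_⟩
  set E : ℂ → ℂ := fun w => Ψ w - Ψ ζ - A * (w - ζ) with hE
  have hEd : ∀ z ∈ ball (0 : ℂ) 1, HasDerivAt E (f z - A) z := by
    intro z hz
    simpa using! ((hder z hz).sub_const (Ψ ζ)).sub (((hasDerivAt_id z).sub_const ζ).const_mul A)
  have hEc : DiffContOnCl ℂ E (ball 0 1) := by
    refine ⟨fun z hz => (hEd z hz).differentiableAt.differentiableWithinAt, ?_⟩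
    have := hΨ.continuous
    exact Continuous.continuousOn (by fun_prop)
  have hEt : HasDerivAt (fun s : ℝ => E (circleMap 0 1 s)) 0 t := by
    have h1 := (ht.hasDerivAt.sub_const (Ψ ζ)).sub
      (((hasDerivAt_circleMap 0 1 t).sub_const ζ).const_mul A)
    have h2 : deriv (Ψ ∘ circleMap 0 1) t - A * (circleMap 0 1 t * I) = 0 := by
      rw [hζ, hA, ← hD]
      field_simp [I_ne_zero]
      simp
    rw [h2] at h1
    exact h1
  have hlip : ∀ w, ‖E w‖ ≤ (K + ‖A‖) * ‖w - ζ‖ := by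
    intro w
    have h1 := hΨ.norm_sub_le w ζ
    calc ‖E w‖ ≤ ‖Ψ w - Ψ ζ‖ + ‖A * (w - ζ)‖ := norm_sub_le _ _
      _ ≤ _ := by rw [norm_mul]; linarith
  rw [hcoe, Metric.tendsto_nhds]
  intro e he
  have hev := eventually_norm_le_of_hasDerivAt_circleMap (E := E)
    (by simp [hE, hζ]) hEt (show 0 < e / 8 by positivity)
  rw [hζ, Metric.eventually_nhds_iff] at hev
  obtain ⟨η, hη, hev⟩ := hev
  -- Beyond distance η the global Lipschitz bound is absorbed into a cubic term. With slope e/8 near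
  -- ζ, the final bound tends to 4·e/8 = e/2 as r → 1.
  set L := (K + ‖A‖) / η ^ 2
  have hL : 0 ≤ L := by positivity
  have hb : ∀ w : ℂ, ‖w‖ = 1 → ‖E w‖ ≤ e / 8 * ‖w - ζ‖ + L * ‖w - ζ‖ ^ 3 := by
    intro w hw
    rcases lt_or_ge ‖w - ζ‖ η with h | h
    · have h1 := hev (by rwa [dist_eq_norm]) hw
      have : 0 ≤ L * ‖w - ζ‖ ^ 3 := by positivity
      linarith
    · have h1 : (K + ‖A‖) * ‖w - ζ‖ ≤ L * ‖w - ζ‖ ^ 3 := by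
        have h2 : L * ‖w - ζ‖ ^ 3 = (K + ‖A‖) * ‖w - ζ‖ * (‖w - ζ‖ ^ 2 / η ^ 2) := by
          simp only [L]
          field_simp
        rw [h2]
        refine le_mul_of_one_le_right (by positivity) ?_
        rw [one_le_div (by positivity)]
        gcongr
      have : 0 ≤ e / 8 * ‖w - ζ‖ := by positivity
      linarith [hlip w]
  have hlim : Tendsto (fun r : ℝ => 4 * (e / 8) + 16 * L * (1 - r ^ 2)) (𝓝[<] 1)
      (𝓝 (4 * (e / 8) + 16 * L * (1 - 1 ^ 2))) :=
    tendsto_nhdsWithin_of_tendsto_nhds (Continuous.tendsto (by fun_prop) 1)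
  filter_upwards [hlim.eventually_lt_const (show _ < e by linarith), self_mem_nhdsWithin,
    mem_nhdsWithin_of_mem_nhds (Ioi_mem_nhds (show (0 : ℝ) < 1 by norm_num))] with r h1 h2 h3
  have hz : (r : ℂ) * ζ ∈ ball (0 : ℂ) 1 := by
    simpa [hζn, abs_of_pos (Set.mem_Ioi.mp h3)] using h2
  have h4 := norm_deriv_le_of_boundary_bound hEc hζn (by positivity) hL hb h3 h2
  rw [(hEd _ hz).deriv] at h4
  rw [dist_eq_norm]
  linarith

/-- Every bounded holomorphic function has a boundary function. -/
theorem exists_isBoundaryFunction {f : ℂ → ℂ} (hf : f ∈ HInf) :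
    ∃ F : Circle → ℂ, IsBoundaryFunction f F := by
  refine ⟨fun ζ => limUnder (𝓝[<] 1) fun r : ℝ => f ((r : ℂ) * (ζ : ℂ)), ?_⟩
  filter_upwards [ae_exists_tendsto_radial hf] with t ht
  exact tendsto_nhds_limUnder ht

/-! ### Blaschke factors and products -/

theorem one_sub_norm_le_norm_one_sub_conj_mul {a z : ℂ} (hz : ‖z‖ ≤ 1) :
    1 - ‖a‖ ≤ ‖1 - (starRingEnd ℂ) a * z‖ := by
  have h1 := norm_sub_norm_le 1 ((starRingEnd ℂ) a * z)
  rw [norm_one, norm_mul, RCLike.norm_conj] at h1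
  nlinarith [norm_nonneg a]

theorem one_sub_conj_mul_ne_zero {a z : ℂ} (ha : ‖a‖ < 1) (hz : ‖z‖ ≤ 1) :
    1 - (starRingEnd ℂ) a * z ≠ 0 := by
  rw [← norm_pos_iff]
  linarith [one_sub_norm_le_norm_one_sub_conj_mul (a := a) hz]

/-- The unimodular constant `|a|/a` in a Blaschke factor, read as `-1` for `a = 0`. -/
noncomputable def blaschkePhase (a : ℂ) : ℂ := if a = 0 then -1 else (‖a‖ : ℂ) / a

theorem norm_blaschkePhase (a : ℂ) : ‖blaschkePhase a‖ = 1 := by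
  rw [blaschkePhase]
  split_ifs with h
  · simp
  · rw [norm_div, norm_real, norm_norm, div_self (norm_ne_zero_iff.mpr h)]

theorem norm_blaschkeFactor (a z : ℂ) :
    ‖blaschkeFactor a z‖ = ‖a - z‖ / ‖1 - (starRingEnd ℂ) a * z‖ := by
  rw [blaschkeFactor, norm_mul, ← blaschkePhase, norm_blaschkePhase, one_mul, norm_div]

theorem norm_blaschkeFactor_le_one {a z : ℂ} (ha : ‖a‖ < 1) (hz : ‖z‖ ≤ 1) :
    ‖blaschkeFactor a z‖ ≤ 1 := by
  rw [norm_blaschkeFactor, div_le_one (norm_pos_iff.mpr (one_sub_conj_mul_ne_zero ha hz)),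
    ← pow_le_pow_iff_left₀ (norm_nonneg _) (norm_nonneg _) two_ne_zero, ← normSq_eq_norm_sq,
    ← normSq_eq_norm_sq]
  have ha2 : a.re * a.re + a.im * a.im ≤ 1 := by
    rw [← normSq_apply, normSq_eq_norm_sq]; nlinarith [norm_nonneg a]
  have hz2 : z.re * z.re + z.im * z.im ≤ 1 := by
    rw [← normSq_apply, normSq_eq_norm_sq]; nlinarith [norm_nonneg z]
  simp only [normSq_apply, sub_re, sub_im, mul_re, mul_im, conj_re, conj_im, one_re, one_im]
  -- This is |1 − āz|² − |a − z|² = (1 − |a|²)(1 − |z|²) ≥ 0.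
  nlinarith [mul_nonneg (sub_nonneg.mpr ha2) (sub_nonneg.mpr hz2)]

/-- For a ≠ 0, b_a(z) − 1 = −(1 − |a|)(1 + (|a|/a)z)/(1 − āz). Hence the Blaschke condition makes
the product converge absolutely; this is where the normalisation |a|/a matters. -/
theorem norm_blaschkeFactor_sub_one_le {a z : ℂ} (ha : ‖a‖ < 1) (hz : ‖z‖ < 1) :
    ‖blaschkeFactor a z - 1‖ ≤ 2 / (1 - ‖z‖) * (1 - ‖a‖) := by
  have hz1 : 0 < 1 - ‖z‖ := by linarith
  by_cases h : a = 0
  · have h1 : ‖blaschkeFactor a z - 1‖ ≤ 2 := by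
      refine (norm_sub_le _ _).trans ?_
      have := norm_blaschkeFactor_le_one ha hz.le
      rw [norm_one]
      linarith
    have h2 : 2 ≤ 2 / (1 - ‖z‖) := by
      rw [le_div_iff₀ hz1]
      nlinarith [norm_nonneg z]
    simpa [h] using h1.trans h2
  · have hne := one_sub_conj_mul_ne_zero ha hz.le
    have hna : (‖a‖ : ℂ) ≠ 0 := by exact_mod_cast norm_ne_zero_iff.mpr h
    have hconj : a * (starRingEnd ℂ) a = (‖a‖ : ℂ) ^ 2 := mul_conj' a
    have heq : blaschkeFactor a z - 1 =
        -((1 - ‖a‖ : ℝ) : ℂ) * (1 + ‖a‖ / a * z) / (1 - (starRingEnd ℂ) a * z) := by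
      rw [blaschkeFactor, if_neg h, eq_div_iff hne, sub_mul, mul_assoc,
        div_mul_cancel₀ _ hne]
      field_simp
      push_cast
      linear_combination z * hconj
    have hnum : ‖1 + ‖a‖ / a * z‖ ≤ 2 := by
      refine (norm_add_le _ _).trans ?_
      have := norm_blaschkePhase a
      rw [blaschkePhase, if_neg h] at this
      rw [norm_mul, this, norm_one]
      linarith
    have hden : 1 - ‖z‖ ≤ ‖1 - (starRingEnd ℂ) a * z‖ := by
      have h1 := norm_sub_norm_le 1 ((starRingEnd ℂ) a * z)
      rw [norm_one, norm_mul, RCLike.norm_conj] at h1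
      nlinarith [norm_nonneg z]
    rw [heq, norm_div, norm_mul, norm_neg, norm_real, Real.norm_of_nonneg (by linarith)]
    calc _ ≤ (1 - ‖a‖) * 2 / (1 - ‖z‖) := by
          have : 0 ≤ 1 - ‖a‖ := by linarith
          gcongr
      _ = _ := by ring

theorem differentiableOn_blaschkeFactor {a : ℂ} (ha : ‖a‖ < 1) :
    DifferentiableOn ℂ (blaschkeFactor a) (ball 0 1) := by
  refine DifferentiableOn.const_mul (DifferentiableOn.fun_div (by fun_prop) (by fun_prop) ?_) _
  intro z hz
  exact one_sub_conj_mul_ne_zero ha (mem_ball_zero_iff.mp hz).le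

section Product

variable {a : ℕ → ℂ}

theorem multipliable_blaschkeFactor (ha : ∀ j, ‖a j‖ < 1) (hs : Summable fun j => 1 - ‖a j‖)
    {z : ℂ} (hz : ‖z‖ < 1) : Multipliable fun j => blaschkeFactor (a j) z := by
  have h : Summable fun j => ‖blaschkeFactor (a j) z - 1‖ :=
    (hs.mul_left _).of_nonneg_of_le (fun _ => norm_nonneg _)
      fun j => norm_blaschkeFactor_sub_one_le (ha j) hz
  simpa using multipliable_one_add_of_summable h

theorem differentiableOn_blaschkeProduct (ha : ∀ j, ‖a j‖ < 1)
    (hs : Summable fun j => 1 - ‖a j‖) :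
    DifferentiableOn ℂ (blaschkeProduct a) (ball 0 1) := by
  intro z hz
  have hz1 : ‖z‖ < 1 := mem_ball_zero_iff.mp hz
  -- The bound 2/(1 − |z|) blows up at the circle, so uniform convergence is only sought on a
  -- smaller disk around 0 containing z.
  obtain ⟨ρ, hzρ, hρ⟩ := exists_between hz1
  have hsub : ball (0 : ℂ) ρ ⊆ ball 0 1 := ball_subset_ball hρ.le
  have hd : ∀ j, DifferentiableOn ℂ (blaschkeFactor (a j)) (ball 0 ρ) :=
    fun j => (differentiableOn_blaschkeFactor (ha j)).mono hsub
  have h := Summable.hasProdLocallyUniformlyOn_one_add (K := ball (0 : ℂ) ρ)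
    (f := fun j z => blaschkeFactor (a j) z - 1) isOpen_ball (hs.mul_left (2 / (1 - ρ)))
    (Eventually.of_forall fun j w hw => by
      have hw' := mem_ball_zero_iff.mp hw
      refine (norm_blaschkeFactor_sub_one_le (ha j) (hw'.trans hρ)).trans ?_
      have h1 : 0 ≤ 1 - ‖a j‖ := by linarith [ha j]
      have h2 : 0 < 1 - ρ := by linarith
      gcongr)
    (fun j => (hd j).continuousOn.sub continuousOn_const)
  rw [hasProdLocallyUniformlyOn_iff_tendstoLocallyUniformlyOn] at h
  simp only [add_sub_cancel] at h
  have hdiff := h.differentiableOn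
    (Eventually.of_forall fun s => DifferentiableOn.fun_finsetProd fun j _ => hd j) isOpen_ball
  exact (hdiff.differentiableAt
    (isOpen_ball.mem_nhds (mem_ball_zero_iff.mpr hzρ))).differentiableWithinAt

/-- The other factors have modulus at most one. This comparison gives |B| ≤ 1, the zeros of B, and
the bound on B/(z − a_j). -/
theorem norm_blaschkeProduct_le_norm_factor (ha : ∀ j, ‖a j‖ < 1)
    (hs : Summable fun j => 1 - ‖a j‖) {z : ℂ} (hz : ‖z‖ < 1) (j : ℕ) :
    ‖blaschkeProduct a z‖ ≤ ‖blaschkeFactor (a j) z‖ := by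
  have h := (multipliable_blaschkeFactor ha hs hz).hasProd.norm
  refine le_of_tendsto h ?_
  filter_upwards [eventually_ge_atTop {j}] with s hjs
  have hj : j ∈ s := hjs (Finset.mem_singleton_self j)
  rw [← Finset.mul_prod_erase s _ hj]
  refine mul_le_of_le_one_right (norm_nonneg _) (Finset.prod_le_one (fun _ _ => norm_nonneg _) ?_)
  exact fun i _ => norm_blaschkeFactor_le_one (ha i) hz.le

theorem norm_blaschkeProduct_le_one (ha : ∀ j, ‖a j‖ < 1)
    (hs : Summable fun j => 1 - ‖a j‖) {z : ℂ} (hz : ‖z‖ < 1) :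
    ‖blaschkeProduct a z‖ ≤ 1 :=
  (norm_blaschkeProduct_le_norm_factor ha hs hz 0).trans (norm_blaschkeFactor_le_one (ha 0) hz.le)

theorem blaschkeProduct_mem_HInf (ha : ∀ j, ‖a j‖ < 1) (hs : Summable fun j => 1 - ‖a j‖) :
    blaschkeProduct a ∈ HInf :=
  ⟨differentiableOn_blaschkeProduct ha hs, 1, fun _ hz =>
    norm_blaschkeProduct_le_one ha hs (mem_ball_zero_iff.mp hz)⟩

theorem blaschkeProduct_apply_zero (ha : ∀ j, ‖a j‖ < 1) (hs : Summable fun j => 1 - ‖a j‖)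
    (j : ℕ) : blaschkeProduct a (a j) = 0 := by
  have h := norm_blaschkeProduct_le_norm_factor ha hs (ha j) j
  rw [norm_blaschkeFactor, sub_self, norm_zero, zero_div] at h
  exact norm_le_zero_iff.mp h

theorem prod_mul_blaschkeProduct_tail (ha : ∀ j, ‖a j‖ < 1) (hs : Summable fun j => 1 - ‖a j‖)
    {z : ℂ} (hz : ‖z‖ < 1) (N : ℕ) :
    blaschkeProduct a z = (∏ i ∈ Finset.range N, blaschkeFactor (a i) z) *
      blaschkeProduct (fun i => a (i + N)) z :=
  (Multipliable.prod_mul_tprod_nat_mul' (f := fun j => blaschkeFactor (a j) z)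
    (multipliable_blaschkeFactor (fun j => ha (j + N))
      ((summable_nat_add_iff N).mpr hs) hz)).symm

/-- Follows from |Π(1 + u_i) − 1| ≤ exp(Σ|u_i|) − 1 and the vanishing tails of Σ(1 − |a_i|). At z =
0 it controls the error in truncating B. -/
theorem tendsto_blaschkeProduct_tail (ha : ∀ j, ‖a j‖ < 1) (hs : Summable fun j => 1 - ‖a j‖)
    {z : ℂ} (hz : ‖z‖ < 1) :
    Tendsto (fun N => blaschkeProduct (fun i => a (i + N)) z) atTop (𝓝 1) := by
  have hbound : ∀ N, ‖blaschkeProduct (fun i => a (i + N)) z - 1‖ ≤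
      Real.exp (2 / (1 - ‖z‖) * ∑' i, (1 - ‖a (i + N)‖)) - 1 := by
    intro N
    have hsN : Summable fun i => 1 - ‖a (i + N)‖ := (summable_nat_add_iff N).mpr hs
    have hm := (multipliable_blaschkeFactor (fun j => ha (j + N)) hsN hz).hasProd
    refine le_of_tendsto ((hm.sub_const 1).norm) (Eventually.of_forall fun s => ?_)
    have h1 := Finset.norm_prod_one_add_sub_one_le s fun i => blaschkeFactor (a (i + N)) z - 1
    simp only [add_sub_cancel] at h1
    refine h1.trans ?_
    gcongr
    rw [← tsum_mul_left]
    refine (Finset.sum_le_sum fun i _ => norm_blaschkeFactor_sub_one_le (ha (i + N)) hz).trans ?_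
    refine (hsN.mul_left _).sum_le_tsum s fun i _ => ?_
    have := ha (i + N)
    exact mul_nonneg (div_nonneg zero_le_two (by linarith)) (by linarith)
  rw [tendsto_iff_norm_sub_tendsto_zero]
  refine squeeze_zero (fun _ => norm_nonneg _) hbound ?_
  have h1 := (tendsto_sum_nat_add fun i => 1 - ‖a i‖).const_mul (2 / (1 - ‖z‖))
  have h2 := ((Real.continuous_exp.tendsto _).comp h1).sub_const 1
  simpa using h2

end Product

/-! ### Separation of almost every radius from a Blaschke sequence -/

open MeasureTheory Real Set in
/-- Almost every point of the circle is nontangentially separated from all but finitely many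
points of a Blaschke sequence. -/
theorem ae_eventually_three_mul_le {a : ℕ → ℂ} (ha : ∀ j, ‖a j‖ < 1)
    (hs : Summable fun j => 1 - ‖a j‖) :
    ∀ᵐ t : ℝ, ∀ᶠ j in cofinite, 3 * (1 - ‖a j‖) ≤ ‖circleMap 0 1 t - a j‖ := by
  -- The line is cut into periods of length 2π, on each of which the Poisson kernel has integral 2π.
  rw [← Measure.restrict_univ (μ := volume), ← iUnion_Ioc_zsmul two_pi_pos, ae_restrict_iUnion_iff]
  intro n
  have hpos : ∀ j (t : ℝ), 0 < ‖circleMap 0 1 t - a j‖ := by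
    intro j t
    have h1 := norm_sub_norm_le (circleMap 0 1 t) (a j)
    rw [norm_circleMap_zero, abs_one] at h1
    linarith [ha j]
  have hcont : ∀ j, Continuous fun t : ℝ =>
      (1 - ‖a j‖) * ((1 - ‖a j‖ ^ 2) / ‖circleMap 0 1 t - a j‖ ^ 2) := fun j =>
    continuous_const.mul (continuous_const.div (by fun_prop) fun t => pow_ne_zero 2 (hpos j t).ne')
  have hnn : ∀ j, 0 ≤ 1 - ‖a j‖ ^ 2 := fun j => by nlinarith [ha j, norm_nonneg (a j)]
  have hint : ∀ j, ∫⁻ t in Ioc (n • (2 * π)) ((n + 1) • (2 * π)),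
      ENNReal.ofReal ((1 - ‖a j‖) * ((1 - ‖a j‖ ^ 2) / ‖circleMap 0 1 t - a j‖ ^ 2)) =
      ENNReal.ofReal ((1 - ‖a j‖) * (2 * π)) := by
    intro j
    have hle : n • (2 * π) ≤ (n + 1) • (2 * π) :=
      zsmul_le_zsmul_left two_pi_pos.le (by omega)
    rw [← ofReal_integral_eq_lintegral_ofReal]
    · rw [← intervalIntegral.integral_of_le hle, intervalIntegral.integral_const_mul]
      congr 2
      have hper : Function.Periodic
          (fun t : ℝ => (1 - ‖a j‖ ^ 2) / ‖circleMap 0 1 t - a j‖ ^ 2) (2 * π) := fun t => by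
        simp only [periodic_circleMap 0 1 t]
      rw [add_zsmul, one_zsmul, hper.intervalIntegral_add_eq (n • (2 * π)) 0, zero_add,
        integral_poissonKernel_eq (mem_ball_zero_iff.mpr (ha j))]
    · exact (hcont j).continuousOn.integrableOn_Icc.mono_set Ioc_subset_Icc_self
    · refine Eventually.of_forall fun t => mul_nonneg (by linarith [ha j]) ?_
      exact div_nonneg (hnn j) (by positivity)
  have hfin : ∫⁻ t in Ioc (n • (2 * π)) ((n + 1) • (2 * π)), ∑' j,
      ENNReal.ofReal ((1 - ‖a j‖) * ((1 - ‖a j‖ ^ 2) / ‖circleMap 0 1 t - a j‖ ^ 2)) ≠ ⊤ := by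
    rw [lintegral_tsum fun j => (hcont j).measurable.ennreal_ofReal.aemeasurable]
    simp_rw [hint]
    exact (hs.mul_right _).tsum_ofReal_ne_top
  have hmeas : Measurable fun t : ℝ => ∑' j,
      ENNReal.ofReal ((1 - ‖a j‖) * ((1 - ‖a j‖ ^ 2) / ‖circleMap 0 1 t - a j‖ ^ 2)) :=
    Measurable.tsum fun j => (hcont j).measurable.ennreal_ofReal
  filter_upwards [ae_lt_top hmeas hfin] with t ht
  have h0 := ENNReal.tendsto_cofinite_zero_of_tsum_ne_top ht.ne
  -- Terms of a finite sum tend to 0, and a term below 1/9 says 9(1 − |a|)²(1 + |a|) < |ζ − a|².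
  have h9 : (0 : ENNReal) < ENNReal.ofReal (1 / 9) := by simp
  filter_upwards [h0.eventually_lt_const h9] with j hj
  rw [ENNReal.ofReal_lt_ofReal_iff (by norm_num), ← mul_div_assoc,
    div_lt_iff₀ (pow_pos (hpos j t) 2)] at hj
  have h1 : 0 ≤ 1 - ‖a j‖ := by linarith [ha j]
  have h2 : 0 ≤ (1 - ‖a j‖) * (1 - ‖a j‖) * ‖a j‖ := by positivity
  refine le_of_sq_le_sq ?_ (hpos j t).le
  nlinarith

/-- With d = |rζ − a|, both |ζ − a| ≤ (1 − r) + d and 1 − r ≤ (1 − |a|) + d hold, so d ≥ 1 − |a|.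
The weaker factor 1/2 matches what is available at the exceptional indices. -/
theorem half_le_norm_radial_sub {a ζ : ℂ} (hζ : ‖ζ‖ = 1) {r : ℝ} (hr0 : 0 ≤ r)
    (hr1 : r < 1) (h : 3 * (1 - ‖a‖) ≤ ‖ζ - a‖) : (1 - ‖a‖) / 2 ≤ ‖r * ζ - a‖ := by
  have hrζ : ‖(r : ℂ) * ζ‖ = r := by rw [norm_mul, hζ, norm_real, Real.norm_of_nonneg hr0, mul_one]
  have hdist : ‖ζ - r * ζ‖ = 1 - r := by
    have : ζ - r * ζ = ((1 - r : ℝ) : ℂ) * ζ := by push_cast; ring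
    rw [this, norm_mul, hζ, norm_real, Real.norm_of_nonneg (by linarith), mul_one]
  have h1 := norm_sub_le_norm_sub_add_norm_sub ζ (r * ζ) a
  have h2 := norm_sub_norm_le a (r * ζ)
  rw [norm_sub_rev, hrζ] at h2
  have h3 := norm_nonneg (r * ζ - a)
  linarith

/-- At almost every boundary point, the radius stays away from the points of a Blaschke sequence,
at the scale of their distance to the boundary. -/
theorem ae_eventually_half_le_norm_radial_sub {a : ℕ → ℂ} (ha : ∀ j, ‖a j‖ < 1)
    (hs : Summable fun j => 1 - ‖a j‖) :
    ∀ᵐ t : ℝ, ∀ᶠ r : ℝ in 𝓝[<] 1, ∀ j,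
      (1 - ‖a j‖) / 2 ≤ ‖r * (Circle.exp t : ℂ) - a j‖ := by
  filter_upwards [ae_eventually_three_mul_le ha hs] with t ht
  have hcoe : (Circle.exp t : ℂ) = circleMap 0 1 t := by simp [circleMap]
  have hζ : ‖circleMap 0 1 t‖ = 1 := by simp
  rw [hcoe]
  generalize circleMap 0 1 t = ζ at ht hζ
  rw [Filter.eventually_cofinite] at ht
  have hfin : ∀ᶠ r : ℝ in 𝓝[<] 1, ∀ j ∈ {j | ¬3 * (1 - ‖a j‖) ≤ ‖ζ - a j‖},
      (1 - ‖a j‖) / 2 ≤ ‖r * ζ - a j‖ := by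
    rw [Set.Finite.eventually_all ht]
    intro j _
    -- The factor 1/2 makes the inequality strict at r = 1, so it persists for r near 1 at each of
    -- the finitely many exceptional indices.
    have hlt : (1 - ‖a j‖) / 2 < ‖((1 : ℝ) : ℂ) * ζ - a j‖ := by
      have h1 := norm_sub_norm_le ζ (a j)
      rw [ofReal_one, one_mul]
      linarith [ha j]
    have hc : Tendsto (fun r : ℝ => ‖r * ζ - a j‖) (𝓝[<] 1) (𝓝 ‖((1 : ℝ) : ℂ) * ζ - a j‖) :=
      tendsto_nhdsWithin_of_tendsto_nhds (Continuous.tendsto (by fun_prop) 1)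
    exact (hc.eventually_const_lt hlt).mono fun r hr => hr.le
  filter_upwards [hfin, self_mem_nhdsWithin,
    mem_nhdsWithin_of_mem_nhds (Ioi_mem_nhds (show (0 : ℝ) < 1 by norm_num))] with r h1 h2 h3 j
  by_cases hj : 3 * (1 - ‖a j‖) ≤ ‖ζ - a j‖
  · exact half_le_norm_radial_sub hζ (Set.mem_Ioi.mp h3).le h2 hj
  · exact h1 j hj

/-! ### Part (a): interpolation of ℓ^1 data -/

section Interpolation

variable {a : ℕ → ℂ} {δ : ℝ}

/-- The `dslope` is B(z)/(z − a_j) with its singularity removed. The value is 1 at a_j and at most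
1/δ in modulus elsewhere; 1 + 1/δ covers both. -/
theorem norm_dslope_blaschkeProduct_div_le (ha : ∀ j, ‖a j‖ < 1)
    (hs : Summable fun j => 1 - ‖a j‖) (hδ : 0 < δ)
    (hB : ∀ j, δ ≤ ‖deriv (blaschkeProduct a) (a j)‖ * (1 - ‖a j‖)) (j : ℕ) {z : ℂ}
    (hz : ‖z‖ < 1) :
    ‖dslope (blaschkeProduct a) (a j) z / deriv (blaschkeProduct a) (a j)‖ ≤ 1 + 1 / δ := by
  have h1 : 0 < 1 - ‖a j‖ := by linarith [ha j]
  have hpos : 0 < ‖deriv (blaschkeProduct a) (a j)‖ :=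
    pos_of_mul_pos_left (hδ.trans_le (hB j)) h1.le
  have hδ' : 0 < 1 / δ := by positivity
  by_cases h : z = a j
  · rw [h, dslope_same, div_self (norm_pos_iff.mp hpos), norm_one]
    linarith
  · have hza : 0 < ‖z - a j‖ := norm_pos_iff.mpr (sub_ne_zero.mpr h)
    rw [dslope_of_ne _ h, slope_def_field, blaschkeProduct_apply_zero ha hs, sub_zero, norm_div,
      norm_div]
    have h2 := norm_blaschkeProduct_le_norm_factor ha hs hz j
    rw [norm_blaschkeFactor, norm_sub_rev] at h2
    have h3 := one_sub_norm_le_norm_one_sub_conj_mul (a := a j) hz.le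
    calc ‖blaschkeProduct a z‖ / ‖z - a j‖ / ‖deriv (blaschkeProduct a) (a j)‖
        ≤ ‖z - a j‖ / (1 - ‖a j‖) / ‖z - a j‖ / ‖deriv (blaschkeProduct a) (a j)‖ := by
          gcongr
          exact h2.trans (by gcongr)
      _ = 1 / (‖deriv (blaschkeProduct a) (a j)‖ * (1 - ‖a j‖)) := by field_simp
      _ ≤ 1 / δ := by gcongr; exact hB j
      _ ≤ 1 + 1 / δ := by linarith

/-- The norm of the coefficients in the partial fraction expansion. -/
theorem norm_div_deriv_blaschkeProduct_le (ha : ∀ j, ‖a j‖ < 1) (hδ : 0 < δ)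
    (hB : ∀ j, δ ≤ ‖deriv (blaschkeProduct a) (a j)‖ * (1 - ‖a j‖)) (w : ℕ → ℂ) (j : ℕ) :
    ‖w j / deriv (blaschkeProduct a) (a j)‖ ≤ ‖w j‖ / δ * (1 - ‖a j‖) := by
  have h1 : 0 < 1 - ‖a j‖ := by linarith [ha j]
  have hpos : 0 < ‖deriv (blaschkeProduct a) (a j)‖ :=
    pos_of_mul_pos_left (hδ.trans_le (hB j)) h1.le
  rw [norm_div, div_mul_eq_mul_div, div_le_div_iff₀ hpos hδ, mul_assoc]
  gcongr
  rw [mul_comm]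
  exact hB j

/-- The points of a Blaschke sequence are distinct if the derivative of the product does not vanish
at any of them. -/
theorem injective_of_deriv_blaschkeProduct_ne_zero (ha : ∀ j, ‖a j‖ < 1)
    (hs : Summable fun j => 1 - ‖a j‖) (hB0 : ∀ j, deriv (blaschkeProduct a) (a j) ≠ 0) :
    Function.Injective a := by
  intro j k hjk
  by_contra hne
  apply hB0 j
  have hle : ∀ z, ‖z‖ < 1 → ‖blaschkeProduct a z‖ ≤
      ‖blaschkeFactor (a j) z‖ * ‖blaschkeFactor (a j) z‖ := by
    intro z hz
    have hm := (multipliable_blaschkeFactor ha hs hz).hasProd.norm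
    refine le_of_tendsto hm ?_
    filter_upwards [eventually_ge_atTop {j, k}] with s hjs
    have hj : j ∈ s := hjs (by simp)
    have hk : k ∈ s.erase j := Finset.mem_erase.mpr ⟨Ne.symm hne, hjs (by simp)⟩
    rw [← Finset.mul_prod_erase s _ hj, ← Finset.mul_prod_erase _ _ hk, hjk, ← mul_assoc]
    refine mul_le_of_le_one_right (by positivity)
      (Finset.prod_le_one (fun _ _ => norm_nonneg _) ?_)
    exact fun i _ => norm_blaschkeFactor_le_one (ha i) hz.le
  have hBo : blaschkeProduct a =O[𝓝 (a j)] fun z => (z - a j) ^ 2 := by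
    refine Asymptotics.IsBigO.of_bound (1 / (1 - ‖a j‖) ^ 2) ?_
    filter_upwards [isOpen_ball.mem_nhds (mem_ball_zero_iff.mpr (ha j))] with z hz
    have hz1 := mem_ball_zero_iff.mp hz
    refine (hle z hz1).trans ?_
    rw [norm_blaschkeFactor, norm_pow, norm_sub_rev (a j) z]
    have h1 := one_sub_norm_le_norm_one_sub_conj_mul (a := a j) hz1.le
    have h2 : 0 < 1 - ‖a j‖ := by linarith [ha j]
    calc _ ≤ ‖z - a j‖ / (1 - ‖a j‖) * (‖z - a j‖ / (1 - ‖a j‖)) := by gcongr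
      _ = _ := by field_simp
  have hder : HasDerivAt (blaschkeProduct a) 0 (a j) := by
    rw [hasDerivAt_iff_isLittleO]
    have hz0 : blaschkeProduct a (a j) = 0 := blaschkeProduct_apply_zero ha hs j
    simp only [hz0, sub_zero, smul_zero]
    refine hBo.trans_isLittleO ?_
    have hlim : Tendsto (fun z : ℂ => z - a j) (𝓝 (a j)) (𝓝 0) :=
      Continuous.tendsto' (by fun_prop) _ _ (sub_self _)
    exact (Asymptotics.isLittleO_pow_id (n := 2) (by norm_num)).comp_tendsto hlim
  exact hder.deriv

/-- Every `ℓ^1` sequence is interpolated by a function in the model space. -/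
theorem ellOne_subset_trace_modelSpace (h : IsInterpolatingBlaschke a) :
    ellOne ⊆ trace (modelSpace (blaschkeProduct a)) a := by
  intro w hw
  have ha : ∀ j, ‖a j‖ < 1 := fun j => mem_ball_zero_iff.mp (h.mem_disk j)
  have hs := h.summable
  obtain ⟨δ, hδ, hB⟩ := h.inf_pos
  have hwn : Summable fun j => ‖w j‖ := by
    simpa using (memℓp_gen_iff (p := 1) (by simp)).mp hw
  set B := blaschkeProduct a with hBdef
  have hBd : DifferentiableOn ℂ B (ball 0 1) := differentiableOn_blaschkeProduct ha hs
  have hB0 : ∀ j, deriv B (a j) ≠ 0 := by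
    intro j h0
    have := hB j
    rw [h0, norm_zero, zero_mul] at this
    linarith
  obtain ⟨c, hc⟩ : ∃ c : ℕ → ℂ, ∀ j, c j = w j / deriv B (a j) := ⟨_, fun _ => rfl⟩
  have hcn : ∀ j, ‖c j‖ ≤ ‖w j‖ / δ * (1 - ‖a j‖) := fun j => by
    rw [hc]
    exact norm_div_deriv_blaschkeProduct_le ha hδ hB w j
  have hpos : ∀ j, 0 < 1 - ‖a j‖ := fun j => by linarith [ha j]
  set f : ℂ → ℂ := fun z => ∑' j, w j * (dslope B (a j) z / deriv B (a j)) with hf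
  set g : ℂ → ℂ := fun z => ∑' j, (starRingEnd ℂ) (c j) * (z / (1 - (starRingEnd ℂ) (a j) * z))
    with hg
  have hfu : Summable fun j => ‖w j‖ * (1 + 1 / δ) := hwn.mul_right _
  have hgu : Summable fun j => ‖w j‖ / δ := hwn.div_const _
  have hfb : ∀ j, ∀ z ∈ ball (0 : ℂ) 1,
      ‖w j * (dslope B (a j) z / deriv B (a j))‖ ≤ ‖w j‖ * (1 + 1 / δ) := by
    intro j z hz
    rw [norm_mul]
    gcongr
    exact norm_dslope_blaschkeProduct_div_le ha hs hδ hB j (mem_ball_zero_iff.mp hz)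
  have hgb : ∀ j, ∀ z : ℂ, ‖z‖ ≤ 1 →
      ‖(starRingEnd ℂ) (c j) * (z / (1 - (starRingEnd ℂ) (a j) * z))‖ ≤ ‖w j‖ / δ := by
    intro j z hz
    rw [norm_mul, RCLike.norm_conj, norm_div]
    have h1 := one_sub_norm_le_norm_one_sub_conj_mul (a := a j) hz
    have := hpos j
    calc _ ≤ ‖w j‖ / δ * (1 - ‖a j‖) * (1 / (1 - ‖a j‖)) := by
          gcongr
          exact hcn j
      _ = ‖w j‖ / δ := by field_simp
  have hfH : f ∈ HInf := by
    refine ⟨differentiableOn_tsum_of_summable_norm hfu (fun j => ?_) isOpen_ball hfb,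
      _, fun z hz => tsum_of_norm_bounded hfu.hasSum fun j => hfb j z hz⟩
    exact (((Complex.differentiableOn_dslope (isOpen_ball.mem_nhds (h.mem_disk j))).mpr
      hBd).div_const _).const_mul _
  have hgH : g ∈ HInf := by
    refine ⟨differentiableOn_tsum_of_summable_norm hgu (fun j => ?_) isOpen_ball
      (fun j z hz => hgb j z (mem_ball_zero_iff.mp hz).le),
      _, fun z hz => tsum_of_norm_bounded hgu.hasSum
        fun j => hgb j z (mem_ball_zero_iff.mp hz).le⟩
    refine DifferentiableOn.const_mul (DifferentiableOn.fun_div (by fun_prop) (by fun_prop) ?_) _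
    intro z hz
    exact one_sub_conj_mul_ne_zero (ha j) (mem_ball_zero_iff.mp hz).le
  have hinj := injective_of_deriv_blaschkeProduct_ne_zero ha hs hB0
  have hfa : ∀ k, f (a k) = w k := by
    intro k
    rw [hf]
    simp only
    rw [tsum_eq_single k]
    · rw [dslope_same, div_self (hB0 k), mul_one]
    · intro j hj
      rw [dslope_of_ne _ fun he => hj (hinj he).symm, slope_def_field, hBdef,
        blaschkeProduct_apply_zero ha hs, blaschkeProduct_apply_zero ha hs]
      simp
  have hfS : ∀ z, ‖z‖ < 1 → (∀ j, z ≠ a j) → f z = B z * ∑' j, c j / (z - a j) := by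
    intro z hz hne
    rw [hf, ← tsum_mul_left]
    refine tsum_congr fun j => ?_
    rw [dslope_of_ne _ (hne j), slope_def_field, hBdef, blaschkeProduct_apply_zero ha hs, hc]
    ring
  obtain ⟨Θ, hΘ⟩ := exists_isBoundaryFunction (blaschkeProduct_mem_HInf ha hs)
  -- The boundary function of f is given as a product, so that the relation with g becomes a
  -- termwise identity on the circle; its radial convergence is the delicate point.
  refine ⟨f, ⟨hfH, g, hgH, by simp [hg], fun ζ => Θ ζ * ∑' j, c j / ((ζ : ℂ) - a j),
    fun ζ => g ζ, Θ, ?_, ?_, hΘ, ?_⟩, hfa⟩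
  · filter_upwards [hΘ, ae_eventually_half_le_norm_radial_sub ha hs] with t ht hsep
    have hlim : Tendsto (fun r : ℝ => ∑' j, c j / (r * (Circle.exp t : ℂ) - a j)) (𝓝[<] 1)
        (𝓝 (∑' j, c j / ((Circle.exp t : ℂ) - a j))) := by
      refine tendsto_tsum_of_dominated_convergence (hwn.mul_right (2 / δ)) (fun j => ?_) ?_
      · have hne : (Circle.exp t : ℂ) - a j ≠ 0 := by
          intro h0
          have h1 := ha j
          rw [← sub_eq_zero.mp h0, Circle.norm_coe] at h1
          exact lt_irrefl _ h1
        have hc1 : ContinuousAt (fun r : ℝ => c j / (r * (Circle.exp t : ℂ) - a j)) 1 := by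
          refine continuousAt_const.div (by fun_prop) ?_
          simpa using hne
        have h2 := hc1.tendsto
        rw [ofReal_one, one_mul] at h2
        exact tendsto_nhdsWithin_of_tendsto_nhds h2
      · filter_upwards [hsep] with r hr j
        rw [norm_div]
        have := hpos j
        calc _ ≤ ‖w j‖ / δ * (1 - ‖a j‖) / ((1 - ‖a j‖) / 2) :=
              div_le_div₀ (by positivity) (hcn j) (by positivity) (hr j)
          _ = _ := by field_simp
    refine (ht.mul hlim).congr' ?_
    filter_upwards [hsep, self_mem_nhdsWithin,
      mem_nhdsWithin_of_mem_nhds (Ioi_mem_nhds (show (0 : ℝ) < 1 by norm_num))] with r h1 h2 h3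
    refine (hfS _ ?_ fun j he => ?_).symm
    · simpa [abs_of_pos (Set.mem_Ioi.mp h3)] using h2
    · have h4 := h1 j
      rw [he, sub_self, norm_zero] at h4
      linarith [hpos j]
  · refine Eventually.of_forall fun t => ?_
    refine tendsto_tsum_of_dominated_convergence hgu (fun j => ?_) ?_
    · have hc1 : ContinuousAt (fun r : ℝ => (starRingEnd ℂ) (c j) * (r * (Circle.exp t : ℂ) /
          (1 - (starRingEnd ℂ) (a j) * (r * (Circle.exp t : ℂ))))) 1 := by
        refine continuousAt_const.mul (ContinuousAt.div (by fun_prop) (by fun_prop) ?_)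
        exact one_sub_conj_mul_ne_zero (ha j) (by simp)
      have h2 := hc1.tendsto
      simp only [ofReal_one, one_mul] at h2
      exact tendsto_nhdsWithin_of_tendsto_nhds h2
    · filter_upwards [self_mem_nhdsWithin,
        mem_nhdsWithin_of_mem_nhds (Ioi_mem_nhds (show (0 : ℝ) < 1 by norm_num))] with r h2 h3 j
      refine hgb j _ ?_
      have h4 : r ≤ 1 := le_of_lt h2
      simpa [abs_of_pos (Set.mem_Ioi.mp h3)] using h4
  · refine Eventually.of_forall fun t => ?_
    simp only [hg]
    rw [conj_tsum]
    congr 1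
    refine tsum_congr fun j => ?_
    set ζ : ℂ := (Circle.exp t : ℂ) with hζ
    have hn : ‖ζ‖ = 1 := Circle.norm_coe _
    have hζ0 : ζ ≠ 0 := norm_pos_iff.mp (by rw [hn]; exact one_pos)
    have hconj : ζ * (starRingEnd ℂ) ζ = 1 := by rw [mul_conj', hn]; simp
    have hne : ζ - a j ≠ 0 := by
      intro h0
      have h1 := ha j
      rw [← sub_eq_zero.mp h0, hn] at h1
      exact lt_irrefl _ h1
    have hne' := one_sub_conj_mul_ne_zero (ha j) hn.le
    have hne2 : 1 - a j * (starRingEnd ℂ) ζ ≠ 0 := by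
      intro h0
      apply hne'
      apply (starRingEnd ℂ).injective
      simpa using h0
    simp only [map_mul, map_div₀, map_sub, map_one, conj_conj]
    rw [div_eq_iff hne, mul_assoc, div_mul_eq_mul_div,
      show (starRingEnd ℂ) ζ * (ζ - a j) = 1 - a j * (starRingEnd ℂ) ζ by
        linear_combination hconj, div_self hne2, mul_one]

end Interpolation

/-! ### Residues for finite Blaschke products -/

/-- A holomorphic function on the disk vanishing at finitely many distinct points is divisible by
the corresponding polynomial. -/
theorem exists_eq_mul_prod_sub {ι : Type*} [DecidableEq ι] (s : Finset ι) (v : ι → ℂ)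
    (hinj : Set.InjOn v s) {Φ : ℂ → ℂ} (hΦ : DifferentiableOn ℂ Φ (ball 0 1))
    (hv : ∀ i ∈ s, v i ∈ ball (0 : ℂ) 1) (h0 : ∀ i ∈ s, Φ (v i) = 0) :
    ∃ q : ℂ → ℂ, DifferentiableOn ℂ q (ball 0 1) ∧
      ∀ z, Φ z = q z * ∏ i ∈ s, (z - v i) := by
  induction s using Finset.induction_on generalizing Φ with
  | empty => exact ⟨Φ, hΦ, fun z => by simp⟩
  | insert k s hk ih =>
    have hkb := hv k (Finset.mem_insert_self k s)
    have hmul : ∀ z, Φ z = (z - v k) * dslope Φ (v k) z := by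
      intro z
      have h1 := sub_smul_dslope Φ (v k) z
      rw [h0 k (Finset.mem_insert_self k s), sub_zero, smul_eq_mul] at h1
      exact h1.symm
    obtain ⟨q, hq, hqe⟩ := ih (Φ := dslope Φ (v k))
      (hinj.mono (by simp))
      ((Complex.differentiableOn_dslope (isOpen_ball.mem_nhds hkb)).mpr hΦ)
      (fun i hi => hv i (Finset.mem_insert_of_mem hi)) (fun i hi => by
        have h2 := hmul (v i)
        rw [h0 i (Finset.mem_insert_of_mem hi)] at h2
        refine (mul_eq_zero.mp h2.symm).resolve_left (sub_ne_zero.mpr fun he => hk ?_)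
        rwa [← hinj (Finset.mem_insert_of_mem hi) (Finset.mem_insert_self k s) he])
    refine ⟨q, hq, fun z => ?_⟩
    rw [Finset.prod_insert hk, hmul z, hqe z]
    ring

/-- The residue theorem for finitely many simple poles in a disk. -/
theorem circleIntegral_div_prod_sub {ι : Type*} [DecidableEq ι] (s : Finset ι) (v : ι → ℂ)
    (hinj : Set.InjOn v s) {Φ : ℂ → ℂ} (hΦ : DifferentiableOn ℂ Φ (ball 0 1)) {ρ : ℝ}
    (hρ0 : 0 < ρ) (hρ1 : ρ < 1) (hv : ∀ i ∈ s, ‖v i‖ < ρ) :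
    ∮ z in C(0, ρ), Φ z / ∏ i ∈ s, (z - v i) =
      2 * Real.pi * I * ∑ i ∈ s, Lagrange.nodalWeight s v i * Φ (v i) := by
  -- After subtracting the Lagrange interpolant, Φ is divisible by Π(z − v_i) and the holomorphic
  -- quotient integrates to zero. The interpolant over the nodal polynomial is already in partial
  -- fractions.
  set p : Polynomial ℂ := Lagrange.interpolate s v fun i => Φ (v i) with hp
  obtain ⟨q, hq, hqe⟩ := exists_eq_mul_prod_sub s v hinj (Φ := fun z => Φ z - p.eval z)
    (hΦ.sub p.differentiable.differentiableOn)
    (fun i hi => mem_ball_zero_iff.mpr ((hv i hi).trans hρ1))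
    (fun i hi => by rw [hp, Lagrange.eval_interpolate_at_node _ hinj hi, sub_self])
  have hne : ∀ z ∈ sphere (0 : ℂ) ρ, ∀ i ∈ s, z ≠ v i := by
    rintro z hz i hi rfl
    have := hv i hi
    rw [mem_sphere_zero_iff_norm.mp hz] at this
    exact lt_irrefl _ this
  have hclosed : closedBall (0 : ℂ) ρ ⊆ ball 0 1 := closedBall_subset_ball hρ1
  have hqc : DiffContOnCl ℂ q (ball 0 ρ) := hq.diffContOnCl_ball hclosed
  have hqi : CircleIntegrable q 0 ρ :=
    (hqc.continuousOn_ball.mono sphere_subset_closedBall).circleIntegrable hρ0.le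
  have hterm : ∀ i ∈ s, CircleIntegrable
      (fun z => Lagrange.nodalWeight s v i * (z - v i)⁻¹ * Φ (v i)) 0 ρ := by
    intro i hi
    refine ContinuousOn.circleIntegrable hρ0.le ?_
    refine (continuousOn_const.mul (ContinuousOn.inv₀ (by fun_prop) ?_)).mul continuousOn_const
    exact fun z hz => sub_ne_zero.mpr (hne z hz i hi)
  have hsum : CircleIntegrable
      (fun z => ∑ i ∈ s, Lagrange.nodalWeight s v i * (z - v i)⁻¹ * Φ (v i)) 0 ρ :=
    CircleIntegrable.fun_sum s hterm
  calc ∮ z in C(0, ρ), Φ z / ∏ i ∈ s, (z - v i)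
      = ∮ z in C(0, ρ), (q z + ∑ i ∈ s, Lagrange.nodalWeight s v i * (z - v i)⁻¹ * Φ (v i)) := by
        refine circleIntegral.integral_congr hρ0.le fun z hz => ?_
        have hP : ∏ i ∈ s, (z - v i) ≠ 0 :=
          Finset.prod_ne_zero_iff.mpr fun i hi => sub_ne_zero.mpr (hne z hz i hi)
        have h1 : Φ z = q z * ∏ i ∈ s, (z - v i) + p.eval z := by rw [← hqe z]; ring
        have h2 := Lagrange.eval_interpolate_not_at_node (fun i => Φ (v i)) (hne z hz)
        rw [Lagrange.eval_nodal] at h2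
        rw [h1, hp, h2, div_eq_iff hP]
        ring
    _ = (∮ z in C(0, ρ), q z) +
        ∑ i ∈ s, ∮ z in C(0, ρ), Lagrange.nodalWeight s v i * (z - v i)⁻¹ * Φ (v i) := by
        rw [circleIntegral.integral_add hqi hsum, circleIntegral.integral_fun_sum hterm]
    _ = _ := by
        rw [hqc.circleIntegral_eq_zero hρ0.le, zero_add, Finset.mul_sum]
        refine Finset.sum_congr rfl fun i hi => ?_
        have h1 := circleIntegral.integral_sub_inv_of_mem_ball (mem_ball_zero_iff.mpr (hv i hi))
        have h2 : ∀ z, Lagrange.nodalWeight s v i * (z - v i)⁻¹ * Φ (v i) =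
            (Lagrange.nodalWeight s v i * Φ (v i)) * (z - v i)⁻¹ := fun z => by ring
        simp_rw [h2]
        rw [circleIntegral.integral_const_mul, h1]
        ring

theorem integral_mul_circleMap_eq (F : ℂ → ℂ) (ρ : ℝ) :
    ∫ t in (0 : ℝ)..2 * Real.pi, F (circleMap 0 ρ t) * circleMap 0 ρ t =
      (∮ z in C(0, ρ), F z) / I := by
  rw [circleIntegral, eq_div_iff I_ne_zero, ← intervalIntegral.integral_mul_const]
  congr 1
  ext t
  rw [deriv_circleMap, smul_eq_mul]
  ring

theorem blaschkeFactor_eq_sub_mul (a z : ℂ) :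
    blaschkeFactor a z = (z - a) * (-blaschkePhase a / (1 - (starRingEnd ℂ) a * z)) := by
  rw [blaschkeFactor, blaschkePhase]
  ring

/-- The integral over a circle of a holomorphic function divided by a finite Blaschke product. -/
theorem integral_div_prod_blaschkeFactor {a : ℕ → ℂ}
    (hinj : Function.Injective a) {Φ : ℂ → ℂ} (hΦ : DifferentiableOn ℂ Φ (ball 0 1)) {ρ : ℝ}
    (hρ0 : 0 < ρ) (hρ1 : ρ < 1) (N : ℕ) (hv : ∀ i < N, ‖a i‖ < ρ) :
    ∫ t in (0 : ℝ)..2 * Real.pi,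
      Φ (circleMap 0 ρ t) / (∏ i ∈ Finset.range N, blaschkeFactor (a i) (circleMap 0 ρ t)) *
        circleMap 0 ρ t =
    2 * Real.pi * ∑ i ∈ Finset.range N, Φ (a i) * ((1 - (starRingEnd ℂ) (a i) * a i) /
      (-blaschkePhase (a i) *
        ∏ j ∈ (Finset.range N).erase i, blaschkeFactor (a j) (a i))) := by
  -- u is the product of (z − a_j)/b_{a_j}(z), which trades the Blaschke denominator for a
  -- polynomial one.
  set u : ℂ → ℂ := fun z => ∏ j ∈ Finset.range N,
    ((1 - (starRingEnd ℂ) (a j) * z) / -blaschkePhase (a j)) with hu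
  have hud : DifferentiableOn ℂ (fun z => Φ z * u z) (ball 0 1) :=
    hΦ.mul (DifferentiableOn.fun_finsetProd fun j _ => by fun_prop)
  have h1 := integral_mul_circleMap_eq
    (fun z => Φ z / ∏ i ∈ Finset.range N, blaschkeFactor (a i) z) ρ
  have h2 : (∮ z in C(0, ρ), Φ z / ∏ i ∈ Finset.range N, blaschkeFactor (a i) z) =
      ∮ z in C(0, ρ), Φ z * u z / ∏ i ∈ Finset.range N, (z - a i) := by
    congr 1
    ext z
    simp only [hu, blaschkeFactor_eq_sub_mul, Finset.prod_mul_distrib, Finset.prod_div_distrib]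
    simp only [div_eq_mul_inv, mul_inv, inv_inv]
    ring
  rw [h1, h2, circleIntegral_div_prod_sub _ _ hinj.injOn hud hρ0 hρ1
    fun i hi => hv i (Finset.mem_range.mp hi), mul_right_comm _ I,
    mul_div_cancel_right₀ _ I_ne_zero]
  congr 1
  refine Finset.sum_congr rfl fun i hi => ?_
  have h3 : u (a i) = ((1 - (starRingEnd ℂ) (a i) * a i) / -blaschkePhase (a i)) *
      ∏ j ∈ (Finset.range N).erase i,
        ((1 - (starRingEnd ℂ) (a j) * a i) / -blaschkePhase (a j)) :=
    (Finset.mul_prod_erase _ _ hi).symm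
  rw [h3, Lagrange.nodalWeight]
  simp only [blaschkeFactor_eq_sub_mul, Finset.prod_mul_distrib, Finset.prod_div_distrib,
    Finset.prod_inv_distrib]
  simp only [div_eq_mul_inv, mul_inv, inv_inv]
  ring

/-! ### Estimates for the pairing on circles |z| = ρ -/

theorem norm_circleMap_of_nonneg {ρ : ℝ} (hρ : 0 ≤ ρ) (t : ℝ) : ‖circleMap 0 ρ t‖ = ρ := by
  rw [norm_circleMap_zero, abs_of_nonneg hρ]

theorem continuous_comp_circleMap {f : ℂ → ℂ} (hf : DifferentiableOn ℂ f (ball 0 1)) {ρ : ℝ}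
    (hρ0 : 0 ≤ ρ) (hρ1 : ρ < 1) : Continuous fun t => f (circleMap 0 ρ t) :=
  hf.continuousOn.comp_continuous (continuous_circleMap 0 ρ) fun t => by
    rw [mem_ball_zero_iff, norm_circleMap_of_nonneg hρ0]
    exact hρ1

theorem one_sub_le_norm_one_sub_real_mul {r : ℝ} (hr0 : 0 ≤ r) {z : ℂ} (hz : ‖z‖ ≤ 1) :
    1 - r ≤ ‖1 - (r : ℂ) * z‖ := by
  have h1 := norm_sub_norm_le 1 ((r : ℂ) * z)
  rw [norm_one, norm_mul, norm_real, Real.norm_of_nonneg hr0] at h1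
  nlinarith

theorem norm_one_div_one_sub_real_mul_le {r : ℝ} (hr0 : 0 ≤ r) (hr1 : r < 1) {z : ℂ}
    (hz : ‖z‖ ≤ 1) : ‖1 / (1 - (r : ℂ) * z)‖ ≤ 1 / (1 - r) := by
  rw [norm_div, norm_one]
  exact one_div_le_one_div_of_le (by linarith) (one_sub_le_norm_one_sub_real_mul hr0 hz)

theorem one_sub_real_mul_ne_zero {r : ℝ} (hr0 : 0 ≤ r) (hr1 : r < 1) {z : ℂ} (hz : ‖z‖ ≤ 1) :
    1 - (r : ℂ) * z ≠ 0 :=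
  norm_pos_iff.mp (by linarith [one_sub_le_norm_one_sub_real_mul hr0 hz])

/-- Pairing of an antiholomorphic function with a Cauchy kernel. -/
theorem norm_integral_conj_mul_kernel_le {g : ℂ → ℂ} (hg : DifferentiableOn ℂ g (ball 0 1))
    {M : ℝ} (hM : ∀ z ∈ ball (0 : ℂ) 1, ‖g z‖ ≤ M) (hg0 : g 0 = 0) {r ρ : ℝ} (hr0 : 0 < r)
    (hr1 : r < 1) (hρ0 : 0 < ρ) (hρ1 : ρ < 1) :
    ‖∫ t in (0 : ℝ)..2 * Real.pi, (starRingEnd ℂ) (g (circleMap 0 ρ t)) *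
      (1 / (1 - (r : ℂ) * circleMap 0 ρ t)) * circleMap 0 ρ t‖ ≤ 2 * Real.pi * (M / r) := by
  -- On |z| = ρ, z̄ = ρ²/z, so conjugation turns the kernel into one with pole at s = rρ². Cauchy's
  -- formula then gives the conjugate of 2π(g(s) − g(0))/r.
  set s : ℂ := ((r * ρ ^ 2 : ℝ) : ℂ) with hs
  have hs0 : 0 < r * ρ ^ 2 := by positivity
  have hrc : (r : ℂ) ≠ 0 := ofReal_ne_zero.mpr hr0.ne'
  have hsρ : s ∈ ball (0 : ℂ) ρ := by
    rw [mem_ball_zero_iff, hs, norm_real, Real.norm_of_nonneg hs0.le]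
    nlinarith [mul_pos hr0 hρ0]
  have hs1 : s ∈ ball (0 : ℂ) 1 := ball_subset_ball hρ1.le hsρ
  have hgc : DiffContOnCl ℂ g (ball 0 ρ) := hg.diffContOnCl_ball (closedBall_subset_ball hρ1)
  have hgs : ContinuousOn g (sphere 0 ρ) := hgc.continuousOn_ball.mono sphere_subset_closedBall
  have hi : ∀ w ∈ ball (0 : ℂ) ρ, CircleIntegrable (fun z => (z - w)⁻¹ * g z) 0 ρ := by
    intro w hw
    refine ContinuousOn.circleIntegrable hρ0.le (ContinuousOn.mul (ContinuousOn.inv₀ (by fun_prop)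
      fun z hz => sub_ne_zero.mpr ?_) hgs)
    rintro rfl
    rw [mem_ball_zero_iff, mem_sphere_zero_iff_norm.mp hz] at hw
    exact lt_irrefl _ hw
  have h0ρ : (0 : ℂ) ∈ ball (0 : ℂ) ρ := mem_ball_self hρ0
  have hcauchy : (∮ z in C(0, ρ), ((z - s)⁻¹ * g z - (z - 0)⁻¹ * g z)) =
      2 * Real.pi * I * g s := by
    have h1 := hgc.circleIntegral_sub_inv_smul hsρ
    have h2 := hgc.circleIntegral_sub_inv_smul h0ρ
    simp only [smul_eq_mul] at h1 h2
    rw [circleIntegral.integral_sub (hi s hsρ) (hi 0 h0ρ), h1, h2, hg0, mul_zero, sub_zero]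
  have hconj : ∀ t : ℝ, (starRingEnd ℂ) (g (circleMap 0 ρ t)) *
      (1 / (1 - (r : ℂ) * circleMap 0 ρ t)) * circleMap 0 ρ t =
      (starRingEnd ℂ) ((fun z => ((z - s)⁻¹ * g z - (z - 0)⁻¹ * g z)) (circleMap 0 ρ t) *
        circleMap 0 ρ t / r) := by
    intro t
    have hn := norm_circleMap_of_nonneg hρ0.le t
    generalize circleMap 0 ρ t = z at hn
    have hz0 : z ≠ 0 := norm_pos_iff.mp (by rw [hn]; exact hρ0)
    have hzz : z * (starRingEnd ℂ) z = (ρ : ℂ) ^ 2 := by rw [mul_conj', hn]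
    have hne : 1 - (r : ℂ) * z ≠ 0 := one_sub_real_mul_ne_zero hr0.le hr1 (by rw [hn]; exact hρ1.le)
    have hne' : 1 - (r : ℂ) * (starRingEnd ℂ) z ≠ 0 := by
      refine one_sub_real_mul_ne_zero hr0.le hr1 ?_
      rw [RCLike.norm_conj, hn]
      exact hρ1.le
    have hzs : z - s = z * (1 - (r : ℂ) * (starRingEnd ℂ) z) := by
      rw [hs]
      push_cast
      linear_combination r * hzz
    have key : ((z - s)⁻¹ * g z - (z - 0)⁻¹ * g z) * z / r =
        g z * (1 / (1 - (r : ℂ) * (starRingEnd ℂ) z)) * (starRingEnd ℂ) z := by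
      rw [hzs, sub_zero]
      generalize (starRingEnd ℂ) z = z' at hne'
      field_simp
      ring
    simp only
    rw [key]
    simp
  simp_rw [hconj]
  rw [intervalIntegral.integral_of_le Real.two_pi_pos.le, integral_conj, RCLike.norm_conj,
    ← intervalIntegral.integral_of_le Real.two_pi_pos.le, intervalIntegral.integral_div,
    integral_mul_circleMap_eq (fun z => (z - s)⁻¹ * g z - (z - 0)⁻¹ * g z), hcauchy]
  simp only [norm_div, norm_mul, norm_I, norm_real, mul_one, div_one, Real.norm_eq_abs,
    abs_of_pos hr0, abs_of_pos Real.pi_pos, RCLike.norm_ofNat]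
  rw [mul_div_assoc]
  gcongr
  exact hM s hs1

/-- A holomorphic function bounded by one that is close to one at the origin is close to one in the
mean. -/
theorem integral_norm_sub_one_le {C : ℂ → ℂ} (hC : DifferentiableOn ℂ C (ball 0 1))
    (hC1 : ∀ z ∈ ball (0 : ℂ) 1, ‖C z‖ ≤ 1) {ρ : ℝ} (hρ0 : 0 < ρ) (hρ1 : ρ < 1) {η : ℝ}
    (hη : 0 < η) :
    ∫ t in (0 : ℝ)..2 * Real.pi, ‖C (circleMap 0 ρ t) - 1‖ ≤
      2 * Real.pi * (η / 2 + (1 - (C 0).re) / η) := by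
  have hc := continuous_comp_circleMap hC hρ0.le hρ1
  have hmean : ∫ t in (0 : ℝ)..2 * Real.pi, (C (circleMap 0 ρ t)).re =
      2 * Real.pi * (C 0).re := by
    have h1 : DiffContOnCl ℂ C (ball 0 ρ) := hC.diffContOnCl_ball (closedBall_subset_ball hρ1)
    have h2 := h1.circleIntegral_sub_inv_smul (mem_ball_self hρ0)
    simp only [smul_eq_mul, sub_zero] at h2
    have h3 := integral_mul_circleMap_eq (fun z => z⁻¹ * C z) ρ
    rw [h2, mul_right_comm, mul_div_cancel_right₀ _ I_ne_zero] at h3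
    have h4 : ∀ t : ℝ, (fun z => z⁻¹ * C z) (circleMap 0 ρ t) * circleMap 0 ρ t =
        C (circleMap 0 ρ t) := by
      intro t
      have : circleMap 0 ρ t ≠ 0 := circleMap_ne_center hρ0.ne'
      simp only
      field_simp
    simp_rw [h4] at h3
    have h5 := reCLM.intervalIntegral_comp_comm (μ := MeasureTheory.volume)
      (hc.intervalIntegrable 0 (2 * Real.pi))
    simp only [reCLM_apply] at h5
    rw [h5, h3]
    simp [mul_re]
  -- For |c| ≤ 1, |c − 1|² ≤ 2 − 2 Re c; then |c − 1| ≤ η/2 + |c − 1|²/(2η). The result is affine in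
  -- Re c, whose mean is Re C(0).
  have hpt : ∀ t, ‖C (circleMap 0 ρ t) - 1‖ ≤
      (η / 2 + 1 / η) - (1 / η) * (C (circleMap 0 ρ t)).re := by
    intro t
    have hn := hC1 (circleMap 0 ρ t) (by
      rw [mem_ball_zero_iff, norm_circleMap_of_nonneg hρ0.le]; exact hρ1)
    generalize C (circleMap 0 ρ t) = c at hn
    have h1 : ‖c - 1‖ ^ 2 ≤ 2 - 2 * c.re := by
      have h2 : ‖c‖ ^ 2 ≤ 1 := by nlinarith [norm_nonneg c]
      rw [← normSq_eq_norm_sq, normSq_apply] at h2 ⊢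
      simp only [sub_re, sub_im, one_re, one_im]
      nlinarith
    have h3 : (η / 2 + 1 / η) - (1 / η) * c.re = (η ^ 2 + (2 - 2 * c.re)) / (2 * η) := by
      field_simp
      ring
    rw [h3, le_div_iff₀ (by positivity)]
    nlinarith [sq_nonneg (‖c - 1‖ - η)]
  have hcre : Continuous fun t => (C (circleMap 0 ρ t)).re := continuous_re.comp hc
  calc _ ≤ ∫ t in (0 : ℝ)..2 * Real.pi,
        ((η / 2 + 1 / η) - (1 / η) * (C (circleMap 0 ρ t)).re) := by
        refine intervalIntegral.integral_mono (by positivity) ?_ ?_ hpt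
        · exact (hc.sub continuous_const).norm.intervalIntegrable _ _
        · exact (continuous_const.sub (continuous_const.mul hcre)).intervalIntegrable _ _
    _ = _ := by
        rw [intervalIntegral.integral_sub intervalIntegrable_const
          (Continuous.intervalIntegrable (by fun_prop) _ _),
          intervalIntegral.integral_const_mul, hmean, intervalIntegral.integral_const, sub_zero,
          smul_eq_mul]
        ring

/-- The boundary relation defining the model space, in the mean on circles `|z| = ρ`, `ρ → 1`. -/
theorem tendsto_integral_norm_sub_mul_conj {f g θ : ℂ → ℂ} (hf : f ∈ HInf) (hg : g ∈ HInf)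
    (hθ : θ ∈ HInf) {F G Θ : Circle → ℂ} (hF : IsBoundaryFunction f F)
    (hG : IsBoundaryFunction g G) (hΘ : IsBoundaryFunction θ Θ)
    (h : ∀ᵐ t : ℝ, F (Circle.exp t) = Θ (Circle.exp t) * (starRingEnd ℂ) (G (Circle.exp t))) :
    Tendsto (fun ρ : ℝ => ∫ t in (0 : ℝ)..2 * Real.pi, ‖f (circleMap 0 ρ t) -
      θ (circleMap 0 ρ t) * (starRingEnd ℂ) (g (circleMap 0 ρ t))‖) (𝓝[<] 1) (𝓝 0) := by
  obtain ⟨hfd, Cf, hCf⟩ := hf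
  obtain ⟨hgd, Cg, hCg⟩ := hg
  obtain ⟨hθd, Cθ, hCθ⟩ := hθ
  suffices hlim : Tendsto (fun ρ : ℝ => ∫ t in (0 : ℝ)..2 * Real.pi, ‖f (circleMap 0 ρ t) -
      θ (circleMap 0 ρ t) * (starRingEnd ℂ) (g (circleMap 0 ρ t))‖) (𝓝[<] 1)
      (𝓝 (∫ _ in (0 : ℝ)..2 * Real.pi, (0 : ℝ))) by simpa using hlim
  have hev : ∀ᶠ ρ : ℝ in 𝓝[<] 1, 0 < ρ ∧ ρ < 1 := by
    filter_upwards [self_mem_nhdsWithin,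
      mem_nhdsWithin_of_mem_nhds (Ioi_mem_nhds (show (0 : ℝ) < 1 by norm_num))] with ρ h1 h2
      using ⟨h2, h1⟩
  refine intervalIntegral.tendsto_integral_filter_of_dominated_convergence
    (fun _ => Cf + Cθ * Cg) ?_ ?_ (Continuous.intervalIntegrable continuous_const _ _) ?_
  · filter_upwards [hev] with ρ hρ
    have h1 := continuous_comp_circleMap hfd hρ.1.le hρ.2
    have h2 := continuous_comp_circleMap hgd hρ.1.le hρ.2
    have h3 := continuous_comp_circleMap hθd hρ.1.le hρ.2
    exact (h1.sub (h3.mul (continuous_conj.comp h2))).norm.aestronglyMeasurable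
  · filter_upwards [hev] with ρ hρ
    refine Eventually.of_forall fun t _ => ?_
    have hz : circleMap 0 ρ t ∈ ball (0 : ℂ) 1 := by
      rw [mem_ball_zero_iff, norm_circleMap_of_nonneg hρ.1.le]
      exact hρ.2
    rw [norm_norm]
    refine (norm_sub_le _ _).trans (add_le_add (hCf _ hz) ?_)
    rw [norm_mul, RCLike.norm_conj]
    exact mul_le_mul (hCθ _ hz) (hCg _ hz) (norm_nonneg _) ((norm_nonneg _).trans (hCθ _ hz))
  · filter_upwards [hF, hG, hΘ, h] with t h1 h2 h3 h4 _
    have hcm : ∀ ρ : ℝ, circleMap 0 ρ t = ρ * (Circle.exp t : ℂ) := fun ρ => by simp [circleMap]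
    simp_rw [hcm]
    have h5 := (h1.sub (h3.mul ((continuous_conj.tendsto _).comp h2))).norm
    rw [h4, sub_self, norm_zero] at h5
    exact h5

/-- A finite Blaschke product is bounded below near the boundary. -/
theorem exists_one_le_mul_norm_prod_blaschkeFactor {a : ℕ → ℂ} (ha : ∀ j, ‖a j‖ < 1) (N : ℕ) :
    ∃ ρ₀ : ℝ, 0 < ρ₀ ∧ ρ₀ < 1 ∧ (∀ i < N, ‖a i‖ < ρ₀) ∧ ∃ K : ℝ, 0 < K ∧
      ∀ z : ℂ, ρ₀ ≤ ‖z‖ → ‖z‖ < 1 →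
        1 ≤ K * ‖∏ i ∈ Finset.range N, blaschkeFactor (a i) z‖ := by
  induction N with
  | zero => exact ⟨1 / 2, by norm_num, by norm_num, by simp, 1, one_pos, by simp⟩
  | succ N ih =>
    obtain ⟨ρ₀, h0, h1, hlt, K, hK, hb⟩ := ih
    have haN := ha N
    have hpos : 0 < 1 - ‖a N‖ := by linarith
    -- Past the midpoint between |a_N| and 1, |a_N − z| ≥ (1 − |a_N|)/2, while |1 − ā_N z| ≤ 2; the
    -- new factor is at least (1 − |a_N|)/4.
    refine ⟨max ρ₀ ((1 + ‖a N‖) / 2), lt_max_of_lt_left h0, max_lt h1 (by linarith), ?_,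
      K * (4 / (1 - ‖a N‖)), by positivity, fun z hz hz1 => ?_⟩
    · intro i hi
      rcases Nat.lt_succ_iff_lt_or_eq.mp hi with h | rfl
      · exact lt_max_of_lt_left (hlt i h)
      · exact lt_max_of_lt_right (by linarith)
    · have h2 := hb z ((le_max_left _ _).trans hz) hz1
      have h3 : (1 + ‖a N‖) / 2 ≤ ‖z‖ := (le_max_right _ _).trans hz
      have h4 : (1 - ‖a N‖) / 4 ≤ ‖blaschkeFactor (a N) z‖ := by
        have hnum : (1 - ‖a N‖) / 2 ≤ ‖a N - z‖ := by
          have := norm_sub_norm_le z (a N)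
          rw [norm_sub_rev] at this
          linarith
        have hden : ‖1 - (starRingEnd ℂ) (a N) * z‖ ≤ 2 := by
          refine (norm_sub_le _ _).trans ?_
          rw [norm_one, norm_mul, RCLike.norm_conj]
          nlinarith [norm_nonneg (a N), norm_nonneg z]
        have hden0 := norm_pos_iff.mpr (one_sub_conj_mul_ne_zero haN hz1.le)
        rw [norm_blaschkeFactor, le_div_iff₀ hden0]
        nlinarith
      have h5 : 1 ≤ 4 / (1 - ‖a N‖) * ‖blaschkeFactor (a N) z‖ := by
        rw [div_mul_eq_mul_div, le_div_iff₀ hpos]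
        linarith
      rw [Finset.prod_range_succ, norm_mul]
      calc (1 : ℝ) ≤ (K * ‖∏ i ∈ Finset.range N, blaschkeFactor (a i) z‖) *
            (4 / (1 - ‖a N‖) * ‖blaschkeFactor (a N) z‖) := one_le_mul_of_one_le_of_one_le h2 h5
        _ = _ := by ring

/-- The residue sums of `f / B` against a Cauchy kernel are controlled by the function `g` with
`f = B \overline{g}` on the circle. -/
theorem norm_sum_residues_le {a : ℕ → ℂ} (ha : ∀ j, ‖a j‖ < 1)
    (hs : Summable fun j => 1 - ‖a j‖) (hinj : Function.Injective a) {f g : ℂ → ℂ}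
    (hf : f ∈ HInf) (hg : g ∈ HInf) (hg0 : g 0 = 0) {F G Θ : Circle → ℂ}
    (hF : IsBoundaryFunction f F) (hG : IsBoundaryFunction g G)
    (hΘ : IsBoundaryFunction (blaschkeProduct a) Θ)
    (h : ∀ᵐ t : ℝ, F (Circle.exp t) = Θ (Circle.exp t) * (starRingEnd ℂ) (G (Circle.exp t)))
    {M : ℝ} (hM : ∀ z ∈ ball (0 : ℂ) 1, ‖g z‖ ≤ M) {r : ℝ} (hr0 : 0 < r) (hr1 : r < 1) (N : ℕ)
    {η : ℝ} (hη : 0 < η) :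
    ‖∑ i ∈ Finset.range N, f (a i) * (1 / (1 - (r : ℂ) * a i)) *
      ((1 - (starRingEnd ℂ) (a i) * a i) / (-blaschkePhase (a i) *
        ∏ j ∈ (Finset.range N).erase i, blaschkeFactor (a j) (a i)))‖ ≤
    M / r + M / (1 - r) *
      (η / 2 + (1 - (blaschkeProduct (fun i => a (i + N)) 0).re) / η) := by
  set C := blaschkeProduct fun i => a (i + N) with hC
  have haN : ∀ j, ‖a (j + N)‖ < 1 := fun j => ha _
  have hsN : Summable fun i => 1 - ‖a (i + N)‖ := (summable_nat_add_iff N).mpr hs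
  have hCd : DifferentiableOn ℂ C (ball 0 1) := differentiableOn_blaschkeProduct haN hsN
  have hC1 : ∀ z ∈ ball (0 : ℂ) 1, ‖C z‖ ≤ 1 := fun z hz =>
    norm_blaschkeProduct_le_one haN hsN (mem_ball_zero_iff.mp hz)
  set P : ℂ → ℂ := fun z => ∏ i ∈ Finset.range N, blaschkeFactor (a i) z with hP
  have hPd : DifferentiableOn ℂ P (ball 0 1) :=
    DifferentiableOn.fun_finsetProd fun j _ => differentiableOn_blaschkeFactor (ha j)
  obtain ⟨ρ₀, hρ₀, hρ₀1, hlt, K, hK, hPb⟩ := exists_one_le_mul_norm_prod_blaschkeFactor ha N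
  have hBP : ∀ z, ‖z‖ < 1 → blaschkeProduct a z = P z * C z := fun z hz =>
    prod_mul_blaschkeProduct_tail ha hs hz N
  have hker : DifferentiableOn ℂ (fun z : ℂ => 1 / (1 - (r : ℂ) * z)) (ball 0 1) :=
    DifferentiableOn.fun_div (by fun_prop) (by fun_prop) fun z hz =>
      one_sub_real_mul_ne_zero hr0.le hr1 (mem_ball_zero_iff.mp hz).le
  have hM0 : 0 ≤ M := (norm_nonneg _).trans (hM 0 (mem_ball_self one_pos))
  have hr' : 0 < 1 - r := by linarith
  set S := ∑ i ∈ Finset.range N, f (a i) * (1 / (1 - (r : ℂ) * a i)) *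
      ((1 - (starRingEnd ℂ) (a i) * a i) / (-blaschkePhase (a i) *
        ∏ j ∈ (Finset.range N).erase i, blaschkeFactor (a j) (a i))) with hS
  have hlim := tendsto_integral_norm_sub_mul_conj hf hg (blaschkeProduct_mem_HInf ha hs) hF hG hΘ h
  have hBd := differentiableOn_blaschkeProduct ha hs
  obtain ⟨hfd, -⟩ := hf
  obtain ⟨hgd, -⟩ := hg
  have hρ : ∀ ρ : ℝ, ρ₀ < ρ → ρ < 1 → 2 * Real.pi * ‖S‖ ≤ 2 * Real.pi * (M / r) +
      (M / (1 - r) * (2 * Real.pi * (η / 2 + (1 - (C 0).re) / η)) + K / (1 - r) *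
        ∫ t in (0 : ℝ)..2 * Real.pi, ‖f (circleMap 0 ρ t) - blaschkeProduct a (circleMap 0 ρ t) *
          (starRingEnd ℂ) (g (circleMap 0 ρ t))‖) := by
    intro ρ hρ₀ρ hρ1
    have hρ0 : 0 < ρ := hρ₀.trans hρ₀ρ
    have hn := norm_circleMap_of_nonneg hρ0.le
    have hz : ∀ t, circleMap 0 ρ t ∈ ball (0 : ℂ) 1 := fun t => by
      rw [mem_ball_zero_iff, hn]; exact hρ1
    have hPK : ∀ t, 1 ≤ K * ‖P (circleMap 0 ρ t)‖ := fun t =>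
      hPb _ (by rw [hn]; exact hρ₀ρ.le) (by rw [hn]; exact hρ1)
    have hP0 : ∀ t, P (circleMap 0 ρ t) ≠ 0 := by
      intro t h0
      have := hPK t
      rw [h0, norm_zero, mul_zero] at this
      linarith
    have hfc := continuous_comp_circleMap hfd hρ0.le hρ1
    have hgc := continuous_conj.comp (continuous_comp_circleMap hgd hρ0.le hρ1)
    have hCc := continuous_comp_circleMap hCd hρ0.le hρ1
    have hPc := continuous_comp_circleMap hPd hρ0.le hρ1
    have hkc := continuous_comp_circleMap hker hρ0.le hρ1
    have hBc := continuous_comp_circleMap hBd hρ0.le hρ1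
    simp only [Function.comp_def] at hgc
    have hzc := continuous_circleMap 0 ρ
    have hres := integral_div_prod_blaschkeFactor hinj (hfd.mul hker) hρ0 hρ1 N
      fun i hi => (hlt i hi).trans hρ₀ρ
    simp only [Pi.mul_apply] at hres
    rw [← hS] at hres
    -- From B = PC, f/P = ḡ + ḡ(C − 1) + (f − Bḡ)/P. T collects the two errors: the first is small
    -- in mean for large N, the second as ρ → 1 with N fixed.
    set T : ℝ → ℂ := fun t => ((starRingEnd ℂ) (g (circleMap 0 ρ t)) * (C (circleMap 0 ρ t) - 1) +
      (f (circleMap 0 ρ t) - blaschkeProduct a (circleMap 0 ρ t) *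
        (starRingEnd ℂ) (g (circleMap 0 ρ t))) / P (circleMap 0 ρ t)) *
        (1 / (1 - (r : ℂ) * circleMap 0 ρ t)) * circleMap 0 ρ t with hT
    have hTc : Continuous T := by
      refine Continuous.mul (Continuous.mul (Continuous.add ?_ ?_) hkc) hzc
      · exact hgc.mul (hCc.sub continuous_const)
      · exact (hfc.sub (hBc.mul hgc)).div hPc hP0
    have hsplit : ∀ t, f (circleMap 0 ρ t) * (1 / (1 - (r : ℂ) * circleMap 0 ρ t)) /
        P (circleMap 0 ρ t) * circleMap 0 ρ t =
        (starRingEnd ℂ) (g (circleMap 0 ρ t)) * (1 / (1 - (r : ℂ) * circleMap 0 ρ t)) *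
          circleMap 0 ρ t + T t := by
      intro t
      have h0 := hP0 t
      simp only [hT]
      rw [hBP _ (mem_ball_zero_iff.mp (hz t))]
      generalize (starRingEnd ℂ) (g (circleMap 0 ρ t)) = g'
      generalize 1 / (1 - (r : ℂ) * circleMap 0 ρ t) = k
      field_simp
      ring
    have hTb : ∀ t, ‖T t‖ ≤ M / (1 - r) * ‖C (circleMap 0 ρ t) - 1‖ + K / (1 - r) *
        ‖f (circleMap 0 ρ t) - blaschkeProduct a (circleMap 0 ρ t) *
          (starRingEnd ℂ) (g (circleMap 0 ρ t))‖ := by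
      intro t
      have hk := norm_one_div_one_sub_real_mul_le hr0.le hr1 (mem_ball_zero_iff.mp (hz t)).le
      have hg' := hM _ (hz t)
      have hPn := norm_pos_iff.mpr (hP0 t)
      simp only [hT]
      generalize f (circleMap 0 ρ t) - blaschkeProduct a (circleMap 0 ρ t) *
        (starRingEnd ℂ) (g (circleMap 0 ρ t)) = d
      rw [norm_mul, norm_mul]
      have h1 : ‖(starRingEnd ℂ) (g (circleMap 0 ρ t)) * (C (circleMap 0 ρ t) - 1) +
          d / P (circleMap 0 ρ t)‖ ≤ M * ‖C (circleMap 0 ρ t) - 1‖ + K * ‖d‖ := by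
        refine (norm_add_le _ _).trans (add_le_add ?_ ?_)
        · rw [norm_mul, RCLike.norm_conj]
          gcongr
        · rw [norm_div, div_le_iff₀ hPn]
          nlinarith [hPK t, norm_nonneg d]
      calc _ ≤ (M * ‖C (circleMap 0 ρ t) - 1‖ + K * ‖d‖) * (1 / (1 - r)) * 1 := by
            gcongr
            exact (mem_ball_zero_iff.mp (hz t)).le
        _ = _ := by ring
    have hgk : Continuous fun t => (starRingEnd ℂ) (g (circleMap 0 ρ t)) *
        (1 / (1 - (r : ℂ) * circleMap 0 ρ t)) * circleMap 0 ρ t := (hgc.mul hkc).mul hzc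
    have hmain : 2 * Real.pi * S = (∫ t in (0 : ℝ)..2 * Real.pi,
        (starRingEnd ℂ) (g (circleMap 0 ρ t)) * (1 / (1 - (r : ℂ) * circleMap 0 ρ t)) *
          circleMap 0 ρ t) + ∫ t in (0 : ℝ)..2 * Real.pi, T t := by
      rw [← hres, ← intervalIntegral.integral_add
        (hgk.intervalIntegrable _ _) (hTc.intervalIntegrable _ _)]
      exact intervalIntegral.integral_congr fun t _ => hsplit t
    have hc1 : Continuous fun t => M / (1 - r) * ‖C (circleMap 0 ρ t) - 1‖ :=
      continuous_const.mul (hCc.sub continuous_const).norm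
    have hc2 : Continuous fun t => K / (1 - r) *
        ‖f (circleMap 0 ρ t) - blaschkeProduct a (circleMap 0 ρ t) *
          (starRingEnd ℂ) (g (circleMap 0 ρ t))‖ :=
      continuous_const.mul (hfc.sub (hBc.mul hgc)).norm
    have hTi : ‖∫ t in (0 : ℝ)..2 * Real.pi, T t‖ ≤ M / (1 - r) *
        (2 * Real.pi * (η / 2 + (1 - (C 0).re) / η)) + K / (1 - r) *
        ∫ t in (0 : ℝ)..2 * Real.pi, ‖f (circleMap 0 ρ t) - blaschkeProduct a (circleMap 0 ρ t) *
          (starRingEnd ℂ) (g (circleMap 0 ρ t))‖ := by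
      refine (intervalIntegral.norm_integral_le_of_norm_le Real.two_pi_pos.le
        (Eventually.of_forall fun t _ => hTb t) ((hc1.add hc2).intervalIntegrable _ _)).trans ?_
      rw [intervalIntegral.integral_add (hc1.intervalIntegrable _ _) (hc2.intervalIntegrable _ _),
        intervalIntegral.integral_const_mul, intervalIntegral.integral_const_mul]
      gcongr
      exact integral_norm_sub_one_le hCd hC1 hρ0 hρ1 hη
    have hnorm : ‖2 * Real.pi * S‖ = 2 * Real.pi * ‖S‖ := by
      simp [abs_of_pos Real.pi_pos]
    rw [← hnorm, hmain]
    exact (norm_add_le _ _).trans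
      (add_le_add (norm_integral_conj_mul_kernel_le hgd hM hg0 hr0 hr1 hρ0 hρ1) hTi)
  have hfinal := ge_of_tendsto (((hlim.const_mul (K / (1 - r))).const_add
    (M / (1 - r) * (2 * Real.pi * (η / 2 + (1 - (C 0).re) / η)))).const_add
      (2 * Real.pi * (M / r))) (b := 2 * Real.pi * ‖S‖) (by
    filter_upwards [self_mem_nhdsWithin, mem_nhdsWithin_of_mem_nhds (Ioi_mem_nhds hρ₀1)]
      with ρ h1 h2 using hρ ρ h2 h1)
  refine le_of_mul_le_mul_left (hfinal.trans_eq ?_) Real.two_pi_pos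
  ring

/-! ### Part (b): increasing real zeros and signs -/

theorem blaschkePhase_ofReal (x : ℝ) (hx : 0 ≤ x) :
    blaschkePhase (x : ℂ) = ((if x = 0 then -1 else 1 : ℝ) : ℂ) := by
  rw [blaschkePhase]
  split_ifs with h1 h2 h2
  · simp
  · exact absurd (ofReal_eq_zero.mp h1) h2
  · exact absurd (ofReal_eq_zero.mpr h2) h1
  · rw [norm_real, Real.norm_of_nonneg hx, div_self h1, ofReal_one]

/-- The restriction to the real axis of the Blaschke factor with zero `x`. -/
noncomputable def realBlaschkeFactor (x y : ℝ) : ℝ :=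
  (if x = 0 then -1 else 1) * ((x - y) / (1 - x * y))

theorem blaschkeFactor_ofReal {x : ℝ} (hx : 0 ≤ x) (y : ℝ) :
    blaschkeFactor (x : ℂ) y = (realBlaschkeFactor x y : ℂ) := by
  have h := blaschkePhase_ofReal x hx
  rw [blaschkePhase] at h
  rw [blaschkeFactor, h, realBlaschkeFactor, conj_ofReal, ofReal_mul, ofReal_div, ofReal_sub,
    ofReal_sub, ofReal_mul, ofReal_one]

/-- The signs of the residues at the points of an increasing sequence: `σ i` is the sign of the
derivative at `x i` of the finite Blaschke products. -/
theorem exists_sign_residues {x : ℕ → ℝ} (hx0 : ∀ i, 0 ≤ x i) (hx1 : ∀ i, x i < 1)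
    (hmono : StrictMono x) :
    ∃ σ : ℕ → ℝ, (∀ i, |σ i| = 1) ∧ ∀ i N, i < N →
      0 < σ i * (-(if x i = 0 then -1 else 1) *
        ∏ j ∈ (Finset.range N).erase i, realBlaschkeFactor (x j) (x i)) := by
  have hden : ∀ i j, 0 < 1 - x j * x i := fun i j => by
    nlinarith [hx0 i, hx0 j, hx1 i, hx1 j]
  have hne : ∀ i j, j ≠ i → realBlaschkeFactor (x j) (x i) ≠ 0 := by
    intro i j hij
    refine mul_ne_zero (by split_ifs <;> norm_num) (div_ne_zero ?_ (hden i j).ne')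
    exact sub_ne_zero.mpr (hmono.injective.ne hij)
  -- For i < N, q i N is (1 − x_i²) times the derivative at x_i of the N-th partial product. Its
  -- sign is fixed from N = i + 1 on, since each later zero x_N > x_i contributes a positive factor.
  set q : ℕ → ℕ → ℝ := fun i N => -(if x i = 0 then -1 else 1) *
    ∏ j ∈ (Finset.range N).erase i, realBlaschkeFactor (x j) (x i) with hq
  have hq0 : ∀ i N, q i N ≠ 0 := fun i N =>
    mul_ne_zero (neg_ne_zero.mpr (by split_ifs <;> norm_num))
      (Finset.prod_ne_zero_iff.mpr fun j hj => hne i j (Finset.ne_of_mem_erase hj))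
  refine ⟨fun i => q i (i + 1) / |q i (i + 1)|, fun i => ?_, fun i N hN => ?_⟩
  · rw [abs_div, abs_abs, div_self (abs_ne_zero.mpr (hq0 _ _))]
  · change 0 < q i (i + 1) / |q i (i + 1)| * q i N
    induction N, hN using Nat.le_induction with
    | base =>
      have := abs_pos.mpr (hq0 i (i + 1))
      rw [div_mul_eq_mul_div]
      exact div_pos (mul_self_pos.mpr (hq0 _ _)) this
    | succ N hN ih =>
      have hNi : N ≠ i := by omega
      have hsucc : q i (N + 1) = q i N * realBlaschkeFactor (x N) (x i) := by
        simp only [hq]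
        rw [Finset.range_add_one, Finset.erase_insert_of_ne hNi,
          Finset.prod_insert (by simp)]
        ring
      have hlt : x i < x N := hmono (by omega)
      have hpos : 0 < realBlaschkeFactor (x N) (x i) := by
        rw [realBlaschkeFactor, if_neg ((hx0 i).trans_lt hlt).ne', one_mul]
        exact div_pos (by linarith) (hden i N)
      rw [hsucc, ← mul_assoc]
      exact mul_pos ih hpos

/-- In a finite sum r → 1 may be taken termwise, and the weights tend to 1. The bound M does not
depend on J, which gives summability. -/
theorem sum_le_of_forall_sum_le {J : ℕ} {x y : ℕ → ℝ} {M : ℝ} (hx : ∀ i, x i < 1)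
    (h : ∀ r, 0 < r → r < 1 →
      ∑ i ∈ Finset.range J, y i * ((1 - x i) / (1 - r * x i)) ≤ M / r) :
    ∑ i ∈ Finset.range J, y i ≤ M := by
  have hl : Tendsto (fun r : ℝ => ∑ i ∈ Finset.range J, y i * ((1 - x i) / (1 - r * x i)))
      (𝓝[<] 1) (𝓝 (∑ i ∈ Finset.range J, y i * ((1 - x i) / (1 - 1 * x i)))) := by
    refine tendsto_finsetSum _ fun i _ => tendsto_nhdsWithin_of_tendsto_nhds ?_
    have h1 : (1 : ℝ) - 1 * x i ≠ 0 := by linarith [hx i]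
    exact tendsto_const_nhds.mul (tendsto_const_nhds.div
      (Continuous.tendsto (by fun_prop) 1) h1)
  have hr : Tendsto (fun r : ℝ => M / r) (𝓝[<] 1) (𝓝 (M / 1)) :=
    tendsto_nhdsWithin_of_tendsto_nhds (tendsto_const_nhds.div tendsto_id one_ne_zero)
  have hle := le_of_tendsto_of_tendsto hl hr (by
    filter_upwards [self_mem_nhdsWithin,
      mem_nhdsWithin_of_mem_nhds (Ioi_mem_nhds (show (0 : ℝ) < 1 by norm_num))] with r h1 h2
      using h r h2 h1)
  rw [div_one] at hle
  refine le_trans (le_of_eq (Finset.sum_congr rfl fun i _ => ?_)) hle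
  rw [one_mul, div_self (by linarith [hx i]), mul_one]

/-- An ideal space contained in the trace of the model space of an increasing sequence is contained
in `ℓ^1`. -/
theorem subset_ellOne_of_subset_trace {x : ℕ → ℝ} (hx0 : ∀ i, 0 ≤ x i) (hx1 : ∀ i, x i < 1)
    (hmono : StrictMono x) (hs : Summable fun j => 1 - x j) {X : Submodule ℂ (ℕ → ℂ)}
    (hX : IsIdealSpace X)
    (hsub : (X : Set (ℕ → ℂ)) ⊆
      trace (modelSpace (blaschkeProduct fun j => (x j : ℂ))) fun j => (x j : ℂ)) :
    (X : Set (ℕ → ℂ)) ⊆ ellOne := by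
  intro w hw
  have hnx : ∀ j, ‖(x j : ℂ)‖ = x j := fun j => by rw [norm_real, Real.norm_of_nonneg (hx0 j)]
  have ha : ∀ j, ‖(x j : ℂ)‖ < 1 := fun j => by rw [hnx]; exact hx1 j
  have hs' : Summable fun j => 1 - ‖(x j : ℂ)‖ := by simpa only [hnx] using hs
  have hinj : Function.Injective fun j => (x j : ℂ) := ofReal_injective.comp hmono.injective
  obtain ⟨σ, hσ1, hσ⟩ := exists_sign_residues hx0 hx1 hmono
  have hy : (fun j => ((σ j * ‖w j‖ : ℝ) : ℂ)) ∈ X := by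
    refine hX w hw _ fun j => ?_
    rw [norm_real, Real.norm_eq_abs, abs_mul, hσ1, one_mul, abs_norm]
  obtain ⟨f, ⟨hf, g, hg, hg0, F, G, Θ, hF, hG, hΘ, hrel⟩, hfy⟩ := hsub hy
  obtain ⟨M, hM⟩ := hg.2
  have hden : ∀ i j, 0 < 1 - x j * x i := fun i j => by
    nlinarith [hx0 i, hx0 j, hx1 i, hx1 j]
  have hterm : ∀ r, 0 < r → r < 1 → ∀ N, ∀ i < N,
      ∃ u : ℝ, ‖w i‖ * ((1 - x i) / (1 - r * x i)) ≤ u ∧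
      f (x i : ℂ) * (1 / (1 - (r : ℂ) * (x i : ℂ))) *
        ((1 - (starRingEnd ℂ) (x i : ℂ) * (x i : ℂ)) / (-blaschkePhase (x i : ℂ) *
          ∏ j ∈ (Finset.range N).erase i, blaschkeFactor (x j : ℂ) (x i : ℂ))) = (u : ℂ) := by
    intro r hr0 hr1 N i hi
    obtain ⟨d, hd⟩ : ∃ d : ℝ, d = -(if x i = 0 then -1 else 1) *
        ∏ j ∈ (Finset.range N).erase i, realBlaschkeFactor (x j) (x i) := ⟨_, rfl⟩
    have hσd : 0 < σ i * d := hd ▸ hσ i N hi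
    have hd1 : |d| ≤ 1 := by
      rw [hd, abs_mul, abs_neg, Finset.abs_prod]
      have h1 : |(if x i = 0 then -1 else 1 : ℝ)| = 1 := by split_ifs <;> simp
      rw [h1, one_mul]
      refine Finset.prod_le_one (fun _ _ => abs_nonneg _) fun j _ => ?_
      have h2 := norm_blaschkeFactor_le_one (ha j) (ha i).le
      rwa [blaschkeFactor_ofReal (hx0 j), norm_real] at h2
    -- Here 0 < σ_i d ≤ 1, so dividing by it only increases the term; this is the lower bound for
    -- 1/|B'(x_i)|.
    have hσd1 : σ i * d ≤ 1 := by
      refine (le_abs_self _).trans ?_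
      rw [abs_mul, hσ1, one_mul]
      exact hd1
    have hσσ : σ i * σ i = 1 := by
      rw [← abs_mul_abs_self, hσ1, one_mul]
    have hrx : 0 < 1 - r * x i := by nlinarith [hx0 i, hx1 i]
    have hd0 : d ≠ 0 := fun h => by simp [h] at hσd
    refine ⟨σ i * ‖w i‖ * (1 / (1 - r * x i)) * ((1 - x i * x i) / d), ?_, ?_⟩
    · have heq : σ i * ‖w i‖ * (1 / (1 - r * x i)) * ((1 - x i * x i) / d) =
          ‖w i‖ * ((1 - x i * x i) / (1 - r * x i)) * (1 / (σ i * d)) := by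
        have hσ0 : σ i ≠ 0 := fun h => by simp [h] at hσd
        field_simp
        linear_combination ‖w i‖ * (1 - x i ^ 2) * hσσ
      rw [heq]
      have h1 : 1 ≤ 1 / (σ i * d) := by rwa [le_div_iff₀ hσd, one_mul]
      have h2 : 1 - x i ≤ 1 - x i * x i := by nlinarith [hx0 i, hx1 i]
      have h3 : 0 ≤ 1 - x i * x i := (hden i i).le
      calc ‖w i‖ * ((1 - x i) / (1 - r * x i))
          ≤ ‖w i‖ * ((1 - x i * x i) / (1 - r * x i)) := by gcongr
        _ ≤ _ := le_mul_of_one_le_right (by positivity) h1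
    · have hprod : ∏ j ∈ (Finset.range N).erase i, blaschkeFactor (x j : ℂ) (x i : ℂ) =
          ((∏ j ∈ (Finset.range N).erase i, realBlaschkeFactor (x j) (x i) : ℝ) : ℂ) := by
        rw [ofReal_prod]
        exact Finset.prod_congr rfl fun j _ => blaschkeFactor_ofReal (hx0 j) _
      rw [hprod, blaschkePhase_ofReal _ (hx0 i), hfy i, conj_ofReal, hd]
      push_cast
      rfl
  have hbound : ∀ J r, 0 < r → r < 1 →
      ∑ i ∈ Finset.range J, ‖w i‖ * ((1 - x i) / (1 - r * x i)) ≤ M / r := by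
    intro J r hr0 hr1
    have hr' : 0 < 1 - r := by linarith
    -- Nonnegativity of the terms lets the sum stop at J while N grows. With r and J fixed, N → ∞
    -- for fixed η, and only then η → 0.
    have hN : ∀ η : ℝ, 0 < η → ∀ N, J ≤ N →
        ∑ i ∈ Finset.range J, ‖w i‖ * ((1 - x i) / (1 - r * x i)) ≤ M / r + M / (1 - r) *
          (η / 2 + (1 - (blaschkeProduct (fun i => (x (i + N) : ℂ)) 0).re) / η) := by
      intro η hη N hJN
      refine le_trans ?_ (norm_sum_residues_le ha hs' hinj hf hg hg0 hF hG hΘ hrel hM hr0 hr1 N hη)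
      choose! u hu1 hu2 using hterm r hr0 hr1 N
      rw [Finset.sum_congr rfl fun i hi => hu2 i (Finset.mem_range.mp hi), ← ofReal_sum, norm_real]
      refine le_trans ?_ (le_abs_self _)
      refine (Finset.sum_le_sum_of_subset_of_nonneg (Finset.range_mono hJN) fun i _ _ => ?_).trans
        (Finset.sum_le_sum fun i hi => hu1 i (Finset.mem_range.mp hi))
      have h1 : 0 < 1 - r * x i := by nlinarith [hx0 i, hx1 i]
      have h2 : 0 ≤ 1 - x i := by linarith [hx1 i]
      positivity
    have hη : ∀ η : ℝ, 0 < η →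
        ∑ i ∈ Finset.range J, ‖w i‖ * ((1 - x i) / (1 - r * x i)) ≤
          M / r + M / (1 - r) * (η / 2) := by
      intro η hη
      have ht := tendsto_blaschkeProduct_tail ha hs' (z := 0) (by simp)
      have h1 := (((((continuous_re.tendsto _).comp ht).const_sub 1).div_const η).const_add
        (η / 2)).const_mul (M / (1 - r)) |>.const_add (M / r)
      simp only [one_re, sub_self, zero_div, add_zero] at h1
      refine ge_of_tendsto h1 ?_
      filter_upwards [eventually_ge_atTop J] with N hJN using hN η hη N hJN
    have h2 : Tendsto (fun η : ℝ => M / r + M / (1 - r) * (η / 2)) (𝓝[>] 0)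
        (𝓝 (M / r + M / (1 - r) * (0 / 2))) :=
      tendsto_nhdsWithin_of_tendsto_nhds (Continuous.tendsto (by fun_prop) 0)
    have h3 := ge_of_tendsto h2 (by filter_upwards [self_mem_nhdsWithin] with η h using hη η h)
    simpa using h3
  have hsum : Summable fun i => ‖w i‖ :=
    summable_of_sum_range_le (fun i => norm_nonneg _)
      fun J => sum_le_of_forall_sum_le hx1 (hbound J)
  exact (memℓp_gen_iff (p := 1) (by simp)).mpr (by simpa using hsum)

end ModelTrace

theorem theorem3 (a : ℕ → ℂ) (ha : ModelTrace.IsInterpolatingBlaschke a) :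
    ModelTrace.ellOne ⊆
        ModelTrace.trace (ModelTrace.modelSpace (ModelTrace.blaschkeProduct a)) a ∧
      ∀ x : ℕ → ℝ, (∀ j, a j = (x j : ℂ)) → 0 ≤ x 0 → StrictMono x →
        ∀ X : Submodule ℂ (ℕ → ℂ), ModelTrace.IsIdealSpace X →
          (X : Set (ℕ → ℂ)) ⊆
            ModelTrace.trace (ModelTrace.modelSpace (ModelTrace.blaschkeProduct a)) a →
          (X : Set (ℕ → ℂ)) ⊆ ModelTrace.ellOne := by
  refine ⟨ModelTrace.ellOne_subset_trace_modelSpace ha, ?_⟩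
  intro x hax hx0 hmono X hX hsub
  obtain rfl : a = fun j => (x j : ℂ) := funext hax
  have hx : ∀ j, 0 ≤ x j := fun j => hx0.trans (hmono.monotone (Nat.zero_le j))
  have hnx : ∀ j, ‖(x j : ℂ)‖ = x j := fun j => by rw [norm_real, Real.norm_of_nonneg (hx j)]
  have hx1 : ∀ j, x j < 1 := fun j => by
    rw [← hnx]
    exact mem_ball_zero_iff.mp (ha.mem_disk j)
  have hs : Summable fun j => 1 - x j := by simpa only [hnx] using ha.summable
  exact ModelTrace.subset_ellOne_of_subset_trace hx hx1 hmono hs hX hsub
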